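/- **Setting.** Let $m\ge 0$ and let $C=\bigoplus_{k\in\mathbb Z}C_k$ be a chain complex of abelian groups with differential $\partial$ of degree $-1$ whose total space is $\mathbb Z^{m}$, such that every standard unit vector $\sigma_1,\dots,\sigma_m$ is homogeneous and $\mathcal K_p=\operatorname{span}\{\sigma_1,\dots,\sigma_p\}$ is a subcomplex for every $0\le p\le m$ (a *standard-form chain complex* with its *canonical filtration* $\mathcal K$). Let $H_k(\mathcal K;\mathbb Z)$ be the persistence module $H_k(\mathcal K_0;\mathbb Z)\to\cdots\to H_k(\mathcal K_m;\mathbb Z)$. For $0\le b<d\le m+1$ the *interval module* $I^{b,d}$ is the persistence module over $\{0,\dots,m\}$ with value $\mathbb Z$ at $b\le i<d$ and $0$ elsewhere, and with identity maps between the copies of $\mathbb Z$. Let $D\in\mathbb Q^{m\times m}$ be the matrix of $\partial$, i.e. $\partial\sigma_j=\sum_iD_{ij}\sigma_i$. For an $m\times m$ matrix $A$ let $A^\perp$ be its anti-transpose, $(A^\perp)_{ij}=A_{m+1-j,\,m+1-i}$; let $\mathrm{low}_j(A)$ be the row index of the last nonzero entry of column $j$ of $A$ (that entry is the *trailing coefficient*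 of the column), and let $\mathrm{lead}_A(r)$ be the column index of the first nonzero entry of row $r$ of $A$. The *standard algorithm* applied to $D^\perp$ starts with $\widehat R=D^\perp$, $\widehat V=I$ and, for $j=1,\dots,m$, as long as there is $j'<j$ such that columns $j'$ and $j$ of $\widehat R$ are nonzero and $\mathrm{low}_{j'}(\widehat R)=\mathrm{low}_j(\widehat R)=i$, subtracts $\widehat R_{ij}/\widehat R_{ij'}$ times column $j'$ from column $j$ in both $\widehat R$ and $\widehat V$. It returns $\widehat R=D^\perp\widehat V$ with $\widehat R$ reduced and $\widehat V$ upper unitriangular. Define $K\in\mathbb Q^{m\times m}$ by $$\mathrm{Row}_i(K)=\begin{cases}\mathrm{Row}_r(\widehat R^\perp)\big/(\widehat R^\perp)_{r,i}&\text{if } \mathrm{lead}_{\widehat R^\perp}(r)=i\text{ for some (unique) } r,\\ \mathrm{Row}_i(\widehat V^\perp)&\text{otherwise,}\end{cases}$$ and let $M=KDK^{-1}$. For a $k$-cycle $z$ of $C$ let $p$ be the least index with $z\in\mathcal K_p$; the *principal submodule* $\mathcal P(z)\subseteq H_k(\mathcal K;\mathbb Z)$ is the smallest submodule $h$ of the persistence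 module $H_k(\mathcal K;\mathbb Z)$ such that $[z]\in h_p$. **Theorem.** The following are equivalent. 1. The trailing coefficient of every nonzero column of $\widehat R$ is a unit of $\mathbb Z$, i.e. $\pm1$. 2. For every $k$, the persistence module $H_k(\mathcal K;\mathbb Z)$ is isomorphic to a finite direct sum of interval modules. 3. For every $k$, each column $\mathrm{Col}_j(K^{-1})$ with $\sigma_j\in C_k$ and $\mathrm{Col}_j(M)=0$ has integer entries and is a $k$-cycle of $C$, each $\mathcal P(\mathrm{Col}_j(K^{-1}))$ with such $j$ is isomorphic to an interval module, and $$H_k(\mathcal K;\mathbb Z)=\bigoplus_{j:\ \sigma_j\in C_k,\ \mathrm{Col}_j(M)=0}\mathcal P\big(\mathrm{Col}_j(K^{-1})\big)$$ as an internal direct sum of submodules of the persistence module. -/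

import Mathlib

open CategoryTheory

/-! ### Persistence modules -/

/-- A (finitely indexed) persistence module over `R`: a functor from the totally ordered set
`{0, 1, ..., m}` to the category of `R`-modules. -/
abbrev PersistenceModule (R : Type) [CommRing R] (m : ℕ) : Type 1 :=
  Fin (m + 1) ⥤ ModuleCat.{0} R

namespace PersistenceModule

variable {R : Type} [CommRing R] {m : ℕ}

/-- The value at `i` of the interval module on `[b, d)`: all of `R` if `b ≤ i < d`, and zero
otherwise. -/
def intervalObj (R : Type) [CommRing R] (b d i : ℕ) : Submodule R R :=
  if b ≤ i ∧ i < d then ⊤ else ⊥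

theorem ite_mem_intervalObj (b d j : ℕ) (x : R) :
    (if b ≤ j ∧ j < d then x else (0 : R)) ∈ intervalObj R b d j := by
  unfold intervalObj
  split_ifs <;> simp

/-- The structure map of the interval module on `[b, d)`: the identity if source and target index
both lie in `[b, d)`, and zero otherwise. (If the target index lies in `[b, d)` and the source
index does not, the source is the zero module.) -/
def intervalMap (R : Type) [CommRing R] (b d i j : ℕ) :
    intervalObj R b d i →ₗ[R] intervalObj R b d j where
  toFun x := ⟨if b ≤ j ∧ j < d then x.1 else 0, ite_mem_intervalObj b d j x.1⟩
  map_add' x y := by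
    ext
    by_cases h : b ≤ j ∧ j < d <;> simp [h]
  map_smul' c x := by
    ext
    by_cases h : b ≤ j ∧ j < d <;> simp [h]

theorem intervalMap_self (b d i : ℕ) : intervalMap R b d i i = LinearMap.id := by
  ext ⟨x, hx⟩
  by_cases h : b ≤ i ∧ i < d
  · simp [intervalMap, h]
  · have : x = 0 := by simpa [intervalObj, h] using hx
    simp [intervalMap, h, this]

theorem intervalMap_comp (b d : ℕ) {i j k : ℕ} (hij : i ≤ j) (hjk : j ≤ k) :
    intervalMap R b d i k = intervalMap R b d j k ∘ₗ intervalMap R b d i j := by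
  ext ⟨x, hx⟩
  by_cases hi : b ≤ i ∧ i < d
  · by_cases hk : b ≤ k ∧ k < d
    · have hj : b ≤ j ∧ j < d := by omega
      simp [intervalMap, hk, hj]
    · simp [intervalMap, hk]
  · have : x = 0 := by simpa [intervalObj, hi] using hx
    simp [intervalMap, this]

/-- The interval module on the half-open interval `[b, d)`. -/
def interval (R : Type) [CommRing R] (m b d : ℕ) : PersistenceModule R m where
  obj i := ModuleCat.of R (intervalObj R b d i)
  map {i j} _ := ModuleCat.ofHom (intervalMap R b d i j)
  map_id i := by rw [intervalMap_self]; rfl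
  map_comp {i j k} f g := by
    rw [intervalMap_comp b d (Fin.le_def.mp (leOfHom f)) (Fin.le_def.mp (leOfHom g))]
    rfl

/-- The (pointwise) direct sum of a family of persistence modules. -/
noncomputable def directSum {ι : Type} (F : ι → PersistenceModule R m) :
    PersistenceModule R m where
  obj p := ModuleCat.of R (DirectSum ι fun i => (F i).obj p)
  map f := ModuleCat.ofHom (DirectSum.lmap fun i => ((F i).map f).hom)
  map_id p := by
    ext x
    simp [DirectSum.lmap_id]
  map_comp f g := by
    ext x
    simp [DirectSum.lmap_comp]

/-- `f` is (isomorphic to) an interval module on some nonempty interval `[b, d)` of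
`{0, 1, ..., m}`. The value `d = m + 1` is that of the intervals that do not end. -/
def IsInterval (f : PersistenceModule R m) : Prop :=
  ∃ b d : ℕ, b < d ∧ d ≤ m + 1 ∧ Nonempty (f ≅ interval R m b d)

/-- `f` splits as a direct sum of interval modules. -/
def SplitsIntoIntervals (f : PersistenceModule R m) : Prop :=
  ∃ (r : ℕ) (b d : Fin r → ℕ), (∀ i, b i < d i ∧ d i ≤ m + 1) ∧
    Nonempty (f ≅ directSum fun i => interval R m (b i) (d i))

/-- A submodule of a persistence module: a family of submodules of the `f_p` that is preserved by
the structure maps. -/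
structure Sub (f : PersistenceModule R m) where
  carrier : ∀ p : Fin (m + 1), Submodule R (f.obj p)
  map_mem : ∀ {p q : Fin (m + 1)} (g : p ⟶ q) (x : f.obj p), x ∈ carrier p →
    (f.map g).hom x ∈ carrier q

namespace Sub

variable {f : PersistenceModule R m}

/-- A submodule of a persistence module, regarded as a persistence module. -/
def toModule (h : Sub f) : PersistenceModule R m where
  obj p := ModuleCat.of R (h.carrier p)
  map {p q} g := ModuleCat.ofHom ((f.map g).hom.restrict fun x hx => h.map_mem g x hx)
  map_id p := by
    ext x
    simp
  map_comp g g' := by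
    ext x
    simp

/-- The smallest submodule `h` of `f` such that `x ∈ h_p`: the intersection of all of them. -/
def generatedBy (p : Fin (m + 1)) (x : f.obj p) : Sub f where
  carrier q := ⨅ h : {h : Sub f // x ∈ h.carrier p}, h.1.carrier q
  map_mem {q q'} g y hy := by
    rw [Submodule.mem_iInf] at hy ⊢
    exact fun h => h.1.map_mem g y (hy h)

end Sub

/-- `f` is the (internal) direct sum of a family of its submodules. -/
def IsInternalDirectSum {f : PersistenceModule R m} {ι : Type} [DecidableEq ι] (h : ι → Sub f) :
    Prop :=
  ∀ p : Fin (m + 1), DirectSum.IsInternal fun i => (h i).carrier p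

end PersistenceModule

/-! ### Standard-form chain complexes -/

/-- The `p`th term of the canonical filtration of `ℤ^m`: the span of the first `p` standard unit
vectors. -/
def canonicalFiltration (m : ℕ) (p : Fin (m + 1)) : Submodule ℤ (Fin m → ℤ) :=
  Submodule.span ℤ {x | ∃ i : Fin m, (i : ℕ) < (p : ℕ) ∧ x = Pi.single i 1}

theorem canonicalFiltration_mono {m : ℕ} {p q : Fin (m + 1)} (h : p ≤ q) :
    canonicalFiltration m p ≤ canonicalFiltration m q := by
  apply Submodule.span_mono
  rintro x ⟨i, hi, rfl⟩
  exact ⟨i, lt_of_lt_of_le hi h, rfl⟩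

theorem mem_canonicalFiltration_last {m : ℕ} (x : Fin m → ℤ) :
    x ∈ canonicalFiltration m (Fin.last m) := by
  rw [← Finset.univ_sum_single x]
  refine Submodule.sum_mem _ fun i _ => ?_
  have : (Pi.single i (x i) : Fin m → ℤ) = x i • Pi.single i 1 := by
    rw [← Pi.single_smul, smul_eq_mul, mul_one]
  rw [this]
  exact Submodule.smul_mem _ _ (Submodule.subset_span ⟨i, i.2, rfl⟩)

/-- A standard-form chain complex: a chain complex `⨁_k C_k` of abelian groups whose total space is
`ℤ^m`, such that each standard unit vector is homogeneous and the span of the first `p` standard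
unit vectors is a subcomplex for every `p`. (These spans are graded subgroups, being generated by
homogeneous elements, so it suffices that the differential preserves them.) -/
structure StandardFormChainComplex (m : ℕ) where
  C : ℤ → Submodule ℤ (Fin m → ℤ)
  isInternal : DirectSum.IsInternal C
  bd : (Fin m → ℤ) →ₗ[ℤ] (Fin m → ℤ)
  bd_mem : ∀ (k : ℤ) (x : Fin m → ℤ), x ∈ C k → bd x ∈ C (k - 1)
  bd_bd : bd ∘ₗ bd = 0
  homogeneous : ∀ i : Fin m, ∃ k : ℤ, (Pi.single i 1 : Fin m → ℤ) ∈ C k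
  bd_mem_filtration : ∀ (p : Fin (m + 1)) (x : Fin m → ℤ),
    x ∈ canonicalFiltration m p → bd x ∈ canonicalFiltration m p

namespace StandardFormChainComplex

variable {m : ℕ} (X : StandardFormChainComplex m)

/-- The `k`-cycles of the subcomplex `K_p`. -/
def cycles (k : ℤ) (p : Fin (m + 1)) : Submodule ℤ (Fin m → ℤ) :=
  (X.C k ⊓ canonicalFiltration m p) ⊓ LinearMap.ker X.bd

/-- The `k`-boundaries of the subcomplex `K_p`. -/
def boundaries (k : ℤ) (p : Fin (m + 1)) : Submodule ℤ (Fin m → ℤ) :=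
  (X.C (k + 1) ⊓ canonicalFiltration m p).map X.bd

theorem cycles_mono (k : ℤ) {p q : Fin (m + 1)} (h : p ≤ q) : X.cycles k p ≤ X.cycles k q :=
  inf_le_inf_right _ (inf_le_inf_left _ (canonicalFiltration_mono h))

theorem boundaries_mono (k : ℤ) {p q : Fin (m + 1)} (h : p ≤ q) :
    X.boundaries k p ≤ X.boundaries k q :=
  Submodule.map_mono (inf_le_inf_left _ (canonicalFiltration_mono h))

theorem boundaries_le_cycles (k : ℤ) (p : Fin (m + 1)) : X.boundaries k p ≤ X.cycles k p := by
  rintro _ ⟨x, ⟨hx, hxp⟩, rfl⟩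
  refine ⟨⟨?_, X.bd_mem_filtration p x hxp⟩, LinearMap.congr_fun X.bd_bd x⟩
  simpa using X.bd_mem _ x hx

/-- The homology group `H_k(K_p; ℤ)`: cycles modulo boundaries. -/
abbrev Homology (k : ℤ) (p : Fin (m + 1)) : Type :=
  X.cycles k p ⧸ (X.boundaries k p).submoduleOf (X.cycles k p)

/-- The map `H_k(K_p; ℤ) → H_k(K_q; ℤ)` induced by the inclusion of `K_p` in `K_q`. -/
def homologyMap (k : ℤ) {p q : Fin (m + 1)} (h : p ≤ q) :
    X.Homology k p →ₗ[ℤ] X.Homology k q :=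
  Submodule.mapQ _ _ (Submodule.inclusion (X.cycles_mono k h))
    fun _ hx => X.boundaries_mono k h hx

/-- The persistence module `H_k(K; ℤ)` of the canonical filtration. -/
def persistentHomology (k : ℤ) : PersistenceModule ℤ m where
  obj p := ModuleCat.of ℤ (X.Homology k p)
  map g := ModuleCat.ofHom (X.homologyMap k (leOfHom g))
  map_id p := by
    apply ModuleCat.hom_ext
    apply Submodule.linearMap_qext
    rfl
  map_comp g g' := by
    apply ModuleCat.hom_ext
    apply Submodule.linearMap_qext
    rfl

/-- The least index `p` such that `z` lies in `K_p`. -/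
noncomputable def birth (z : Fin m → ℤ) : Fin (m + 1) :=
  open scoped Classical in
  (Finset.univ.filter fun p => z ∈ canonicalFiltration m p).min'
    ⟨Fin.last m, by simp [mem_canonicalFiltration_last]⟩

theorem mem_canonicalFiltration_birth (z : Fin m → ℤ) : z ∈ canonicalFiltration m (birth z) := by
  classical
  have h := Finset.min'_mem (Finset.univ.filter fun p => z ∈ canonicalFiltration m p)
    ⟨Fin.last m, by simp [mem_canonicalFiltration_last]⟩
  exact (Finset.mem_filter.mp h).2

theorem mem_cycles_birth {k : ℤ} {z : Fin m → ℤ} (hz : z ∈ X.cycles k (Fin.last m)) :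
    z ∈ X.cycles k (birth z) :=
  ⟨⟨hz.1.1, mem_canonicalFiltration_birth z⟩, hz.2⟩

/-- The principal submodule `P(z)` of `H_k(K; ℤ)` generated by a `k`-cycle `z` of the whole
complex: the smallest submodule that contains the class of `z` at the least index `p` such that
`z` lies in `K_p`. -/
noncomputable def principal (k : ℤ) (z : X.cycles k (Fin.last m)) :
    PersistenceModule.Sub (X.persistentHomology k) :=
  PersistenceModule.Sub.generatedBy (f := X.persistentHomology k) (birth z.1)
    (Submodule.Quotient.mk (⟨z.1, X.mem_cycles_birth z.2⟩ : X.cycles k (birth z.1)))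

/-- The matrix of the differential, regarded as a rational matrix:
`∂ σ_j = ∑ i, D_ij σ_i`. -/
def boundaryMatrix : Matrix (Fin m) (Fin m) ℚ :=
  (LinearMap.toMatrix' X.bd).map (Int.cast : ℤ → ℚ)

end StandardFormChainComplex

/-! ### The standard algorithm -/

section Algorithm

variable {F : Type} [Field F] [DecidableEq F] {m : ℕ}

/-- The index of the last nonzero entry of column `j` of `R`; `⊥` if the column is zero. -/
def low (R : Matrix (Fin m) (Fin m) F) (j : Fin m) : WithBot (Fin m) :=
  (Finset.univ.filter fun i => R i j ≠ 0).max

/-- The index of the first nonzero entry of row `r` of `A`; `⊤` if the row is zero. -/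
def lead (A : Matrix (Fin m) (Fin m) F) (r : Fin m) : WithTop (Fin m) :=
  (Finset.univ.filter fun j => A r j ≠ 0).min

/-- The anti-transpose: transpose and reverse the order of the rows and of the columns. -/
def antiTranspose (A : Matrix (Fin m) (Fin m) F) : Matrix (Fin m) (Fin m) F :=
  Matrix.of fun i j => A j.rev i.rev

/-- Subtract `c` times column `j'` from column `j`. -/
def subCol (A : Matrix (Fin m) (Fin m) F) (j j' : Fin m) (c : F) : Matrix (Fin m) (Fin m) F :=
  A.updateCol j fun a => A a j - c * A a j'

theorem low_subCol_lt {R : Matrix (Fin m) (Fin m) F} {i j j' : Fin m} (hj : low R j = i)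
    (hj' : low R j' = i) : low (subCol R j j' (R i j / R i j')) j < low R j := by
  rw [hj]
  have hne : R i j' ≠ 0 := (Finset.mem_filter.mp (Finset.mem_of_max hj')).2
  have hz : ∀ c : Fin m, low R c = i → ∀ a, i < a → R a c = 0 := by
    intro c hc a ha
    by_contra h
    have := Finset.le_max (s := Finset.univ.filter fun i => R i c ≠ 0) (a := a) (by simp [h])
    rw [show (Finset.univ.filter fun i => R i c ≠ 0).max = low R c from rfl, hc] at this
    exact absurd (WithBot.coe_le_coe.mp this) (not_le.mpr ha)
  rw [low, Finset.max_eq_sup_withBot, Finset.sup_lt_iff (WithBot.bot_lt_coe i)]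
  intro a ha
  have ha' : R a j - R i j / R i j' * R a j' ≠ 0 := by simpa [subCol] using ha
  rw [WithBot.coe_lt_coe]
  by_contra hlt
  rcases (not_lt.mp hlt).lt_or_eq with h | h
  · exact ha' (by rw [hz j hj a h, hz j' hj' a h]; simp)
  · subst h
    exact ha' (by rw [div_mul_cancel₀ _ hne, sub_self])

/-- Termination of the while-loop below is measured by the order on `WithBot (Fin m)`. -/
instance lowWellFounded : WellFoundedRelation (WithBot (Fin m)) := ⟨(· < ·), wellFounded_lt⟩

/-- The while-loop of the standard algorithm for column `j`: as long as some earlier column `j'`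
has its last nonzero entry in the same row `i` as column `j`, subtract `R_ij / R_ij'` times
column `j'` from column `j`, in both matrices `R` and `V`. -/
noncomputable def reduceColumn (j : Fin m) (R V : Matrix (Fin m) (Fin m) F) :
    Matrix (Fin m) (Fin m) F × Matrix (Fin m) (Fin m) F :=
  open scoped Classical in
  if h : ∃ ij' : Fin m × Fin m, ij'.2 < j ∧ low R ij'.2 = ij'.1 ∧ low R j = ij'.1 then
    reduceColumn j
      (subCol R j h.choose.2 (R h.choose.1 j / R h.choose.1 h.choose.2))
      (subCol V j h.choose.2 (R h.choose.1 j / R h.choose.1 h.choose.2))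
  else (R, V)
termination_by low R j
decreasing_by exact low_subCol_lt h.choose_spec.2.2 h.choose_spec.2.1

/-- The standard algorithm: start with `R = D` and `V = 1` and process the columns from left to
right. The output is the pair `(R, V)`. -/
noncomputable def standardAlgorithm (D : Matrix (Fin m) (Fin m) F) :
    Matrix (Fin m) (Fin m) F × Matrix (Fin m) (Fin m) F :=
  (List.finRange m).foldl (fun RV j => reduceColumn j RV.1 RV.2) (D, 1)

end Algorithm

/-- Every nonzero column of the rational matrix `R` has a unit of `ℤ` as its last nonzero
entry. -/
def HasUnitTrailingCoefficients {m : ℕ} (R : Matrix (Fin m) (Fin m) ℚ) : Prop :=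
  ∀ i j : Fin m, low R j = i → ∃ u : ℤˣ, R i j = ((u : ℤ) : ℚ)

namespace StandardFormChainComplex

variable {m : ℕ} (X : StandardFormChainComplex m)

/-- The reduced matrix of the decomposition of the anti-transposed boundary matrix that the
standard algorithm returns. -/
noncomputable def Rhat : Matrix (Fin m) (Fin m) ℚ :=
  (standardAlgorithm (antiTranspose X.boundaryMatrix)).1

/-- The upper unitriangular matrix of the decomposition of the anti-transposed boundary matrix that
the standard algorithm returns. -/
noncomputable def Vhat : Matrix (Fin m) (Fin m) ℚ :=
  (standardAlgorithm (antiTranspose X.boundaryMatrix)).2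

/-- The matrix `K`: its `i`th row is the `r`th row of the anti-transpose of `Rhat` divided by its
leading entry, if that entry is in column `i` for some (unique) `r`, and the `i`th row of the
anti-transpose of `Vhat` otherwise. -/
noncomputable def matK : Matrix (Fin m) (Fin m) ℚ :=
  open scoped Classical in
  Matrix.of fun i =>
    if h : ∃ r : Fin m, lead (antiTranspose X.Rhat) r = i then
      fun j => antiTranspose X.Rhat h.choose j / antiTranspose X.Rhat h.choose i
    else fun j => antiTranspose X.Vhat i j

/-- The matrix `M = K D K⁻¹`. -/
noncomputable def matM : Matrix (Fin m) (Fin m) ℚ :=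
  X.matK * X.boundaryMatrix * X.matK⁻¹

/-- The indices `j` such that `σ_j ∈ C_k` and column `j` of `M` is zero. -/
def EIndex (k : ℤ) : Type :=
  {j : Fin m // (Pi.single j 1 : Fin m → ℤ) ∈ X.C k ∧ ∀ i, X.matM i j = 0}

instance (k : ℤ) : DecidableEq (X.EIndex k) :=
  inferInstanceAs (DecidableEq {_j : Fin m // _})

end StandardFormChainComplex

/-! ### The standard algorithm and its loop invariants. -/

section Algorithm

/-! Write `S` and `A` for the anti-transposes of `Rhat` and `Vhat`. Then `S = A * D` is a row
reduction of `D`: `A` is upper unitriangular and nonzero rows of `S` have distinct leading columns.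
From `D * D = 0` it follows that row `i` of `S` vanishes whenever `i` is a leading column
(`row_eq_zero_of_lead`). Hence `K * D = L * K`, where `L` keeps only the leading entries of `S`; so
`M = L`, and the columns `v_j` of `K⁻¹` form a rational basis with `∂ v_j = S_ij v_i` if row `i`
leads in column `j`, and `∂ v_j = 0` if no row does. As `K` is upper unitriangular and homogeneous,
this basis respects filtration and grading.

1 → 3: with unit leading entries, `K` and `K⁻¹` are integral, so the `v_j` form a basis over `ℤ` in
which `∂` is a signed matching (`BarcodeBasis`). Each cycle `v_i` then generates an interval, which
ends when its partner enters, and these intervals sum to the homology. 3 → 2 is formal.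

2 → 1: sums of intervals are torsion-free, and so are the cokernels of their structure maps. By the
long exact sequence of a pair, the relative homology of `K_p ⊆ K_q` is torsion-free
(`exists_eq_bd_add_of_smul_eq`). Go through the rows of `S` from the bottom up. If the rows below
`r` have unit leads, row `r` of `A` is an integer vector `w`. Let row `r` have lead `c` in column
`l`. An integer multiple `n v_l` has boundary `c n v_r`, so `c n σ_r` is a boundary modulo the span
of the vectors before `σ_r`. Torsion-freeness gives `σ_r = ∂y' + u'` with `u'` in that span. Pairing
with `w` yields `1 = c y'_l`, so `c` is a unit. -/

theorem antiTranspose_antiTranspose {F : Type} {m : ℕ} (A : Matrix (Fin m) (Fin m) F) :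
    antiTranspose (antiTranspose A) = A := by
  ext i j
  simp [antiTranspose]

variable {F : Type} [Field F] {m : ℕ}

theorem antiTranspose_mul (A B : Matrix (Fin m) (Fin m) F) :
    antiTranspose (A * B) = antiTranspose B * antiTranspose A := by
  ext i j
  simp only [antiTranspose, Matrix.of_apply, Matrix.mul_apply]
  rw [← Equiv.sum_comp Fin.revPerm]
  exact Finset.sum_congr rfl fun a _ => mul_comm _ _

theorem subCol_apply_self (A : Matrix (Fin m) (Fin m) F) (j j' : Fin m) (c : F) (a : Fin m) :
    subCol A j j' c a j = A a j - c * A a j' := by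
  simp [subCol]

theorem subCol_apply_of_ne (A : Matrix (Fin m) (Fin m) F) {j b : Fin m} (h : b ≠ j) (j' : Fin m)
    (c : F) (a : Fin m) : subCol A j j' c a b = A a b := by
  simp [subCol, h]

theorem mul_subCol (D V : Matrix (Fin m) (Fin m) F) (j j' : Fin m) (c : F) :
    D * subCol V j j' c = subCol (D * V) j j' c := by
  ext a b
  by_cases h : b = j
  · subst h
    simp only [Matrix.mul_apply, subCol_apply_self, mul_sub, Finset.sum_sub_distrib,
      Finset.mul_sum]
    congr 1
    exact Finset.sum_congr rfl fun _ _ => by ring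
  · simp only [Matrix.mul_apply, subCol_apply_of_ne _ h]

theorem subring_mul_mem_apply {O : Subring F} {D V : Matrix (Fin m) (Fin m) F} {j : Fin m}
    (hD : ∀ i j, D i j ∈ O) (hV : ∀ i, V i j ∈ O) (i : Fin m) : (D * V) i j ∈ O := by
  rw [Matrix.mul_apply]
  exact Subring.sum_mem _ fun a _ => O.mul_mem (hD _ _) (hV _)

theorem exists_ne_zero_of_mul_apply_ne_zero {A B : Matrix (Fin m) (Fin m) F} {i j : Fin m}
    (h : (A * B) i j ≠ 0) : ∃ a, A i a ≠ 0 ∧ B a j ≠ 0 := by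
  rw [Matrix.mul_apply] at h
  obtain ⟨a, -, ha⟩ := Finset.exists_ne_zero_of_sum_ne_zero h
  exact ⟨a, left_ne_zero_of_mul ha, right_ne_zero_of_mul ha⟩

variable [DecidableEq F]

theorem low_eq_coe_iff {R : Matrix (Fin m) (Fin m) F} {i j : Fin m} :
    low R j = i ↔ R i j ≠ 0 ∧ ∀ a, i < a → R a j = 0 := by
  constructor
  · intro h
    refine ⟨(Finset.mem_filter.mp (Finset.mem_of_max h)).2, fun a ha => ?_⟩
    by_contra hne
    have := Finset.le_max (s := Finset.univ.filter fun i => R i j ≠ 0) (a := a) (by simp [hne])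
    rw [show (Finset.univ.filter fun i => R i j ≠ 0).max = low R j from rfl, h] at this
    exact absurd (WithBot.coe_le_coe.mp this) (not_le.mpr ha)
  · rintro ⟨h, h'⟩
    refine le_antisymm (Finset.max_le fun a ha => ?_) (Finset.le_max (by simp [h]))
    rw [WithBot.coe_le_coe]
    by_contra hlt
    exact (Finset.mem_filter.mp ha).2 (h' a (not_le.mp hlt))

theorem lead_eq_coe_iff {A : Matrix (Fin m) (Fin m) F} {r i : Fin m} :
    lead A r = i ↔ A r i ≠ 0 ∧ ∀ a, a < i → A r a = 0 := by
  constructor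
  · intro h
    refine ⟨(Finset.mem_filter.mp (Finset.mem_of_min h)).2, fun a ha => ?_⟩
    by_contra hne
    have := Finset.min_le (s := Finset.univ.filter fun i => A r i ≠ 0) (a := a) (by simp [hne])
    rw [show (Finset.univ.filter fun i => A r i ≠ 0).min = lead A r from rfl, h] at this
    exact absurd (WithTop.coe_le_coe.mp this) (not_le.mpr ha)
  · rintro ⟨h, h'⟩
    refine le_antisymm (Finset.min_le (by simp [h])) (Finset.le_min fun a ha => ?_)
    rw [WithTop.coe_le_coe]
    by_contra hlt
    exact (Finset.mem_filter.mp ha).2 (h' a (not_le.mp hlt))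

theorem lead_eq_top_iff {A : Matrix (Fin m) (Fin m) F} {r : Fin m} :
    lead A r = ⊤ ↔ ∀ a, A r a = 0 := by
  rw [lead, Finset.min_eq_top, Finset.filter_eq_empty_iff]
  simp

theorem low_eq_of_col_eq {R R' : Matrix (Fin m) (Fin m) F} {j : Fin m}
    (h : ∀ i, R' i j = R i j) : low R' j = low R j := by
  simp only [low, h]

theorem lead_antiTranspose {R : Matrix (Fin m) (Fin m) F} {r i : Fin m} :
    lead (antiTranspose R) r = i ↔ low R r.rev = i.rev := by
  rw [lead_eq_coe_iff, low_eq_coe_iff]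
  simp only [antiTranspose, Matrix.of_apply]
  refine and_congr_right fun _ => ⟨fun h a ha => ?_, fun h a ha => h _ (Fin.rev_lt_rev.mpr ha)⟩
  simpa using h a.rev (Fin.rev_lt_iff.mp ha)

/-- The loop picks its pair by choice, so an invariant must survive every admissible subtraction. -/
theorem reduceColumn_induction (j : Fin m)
    (P : Matrix (Fin m) (Fin m) F → Matrix (Fin m) (Fin m) F → Prop)
    (step : ∀ (R V : Matrix (Fin m) (Fin m) F) (i j' : Fin m), j' < j → low R j' = i →
      low R j = i → P R V →
      P (subCol R j j' (R i j / R i j')) (subCol V j j' (R i j / R i j')))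
    (R V : Matrix (Fin m) (Fin m) F) (h : P R V) :
    P (reduceColumn j R V).1 (reduceColumn j R V).2 := by
  fun_induction reduceColumn j R V with
  | case1 R V hex ih =>
    exact ih (step R V _ _ hex.choose_spec.1 hex.choose_spec.2.1 hex.choose_spec.2.2 h)
  | case2 R V hex => exact h

/-- This is the exit condition of the loop. -/
theorem reduceColumn_reduced (j : Fin m) (R V : Matrix (Fin m) (Fin m) F) :
    ∀ i j' : Fin m, j' < j → low (reduceColumn j R V).1 j' = i →
      low (reduceColumn j R V).1 j ≠ i := by
  fun_induction reduceColumn j R V with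
  | case1 R V hex ih => exact ih
  | case2 R V hex => exact fun i j' h1 h2 h3 => hex ⟨(i, j'), h1, h2, h3⟩

theorem reduceColumn_apply_of_ne (j : Fin m) (R V : Matrix (Fin m) (Fin m) F) {b : Fin m}
    (hb : b ≠ j) : (∀ a, (reduceColumn j R V).1 a b = R a b) ∧
      ∀ a, (reduceColumn j R V).2 a b = V a b :=
  reduceColumn_induction j (fun R' V' => (∀ a, R' a b = R a b) ∧ ∀ a, V' a b = V a b)
    (fun R' V' i j' _ _ _ h =>
      ⟨fun a => by rw [subCol_apply_of_ne _ hb, h.1], fun a => by rw [subCol_apply_of_ne _ hb, h.2]⟩)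
    R V ⟨fun _ => rfl, fun _ => rfl⟩

theorem standardAlgorithm_induction (D : Matrix (Fin m) (Fin m) F)
    (P : ℕ → Matrix (Fin m) (Fin m) F → Matrix (Fin m) (Fin m) F → Prop) (h0 : P 0 D 1)
    (hs : ∀ (j : Fin m) (R V : Matrix (Fin m) (Fin m) F), P j R V →
      P (j + 1) (reduceColumn j R V).1 (reduceColumn j R V).2) :
    P m (standardAlgorithm D).1 (standardAlgorithm D).2 := by
  have key : ∀ n ≤ m, ∀ s, s = ((List.finRange m).take n).foldl
      (fun RV j => reduceColumn j RV.1 RV.2) (D, 1) → P n s.1 s.2 := by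
    intro n
    induction n with
    | zero => rintro - s rfl; simpa using h0
    | succ n ih =>
      rintro hn s rfl
      have := hs ⟨n, hn⟩ _ _ (ih (by omega) _ rfl)
      rw [List.take_add_one, List.foldl_append]
      simpa [List.getElem?_eq_getElem (l := List.finRange m) (i := n) (by simpa using hn)] using this
  refine key m le_rfl _ ?_
  rw [List.take_of_length_le (by simp)]
  rfl

/-- The state of the standard algorithm after `n` columns of `D` have been processed. -/
structure IsPartialReduction (D : Matrix (Fin m) (Fin m) F) (n : ℕ)
    (R V : Matrix (Fin m) (Fin m) F) : Prop where
  eq_mul : R = D * V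
  diag : ∀ j, V j j = 1
  upper : ∀ i j, j < i → V i j = 0
  initial : ∀ j : Fin m, n ≤ j → ∀ i, V i j = (1 : Matrix (Fin m) (Fin m) F) i j
  reduced : ∀ i j j' : Fin m, j' < j → (j : ℕ) < n → low R j' = i → low R j ≠ i
  graded : ∀ g : Fin m → ℤ, (∀ i j, D i j ≠ 0 → g i = g j + 1) →
    ∀ i j, V i j ≠ 0 → g i = g j
  integral : ∀ O : Subring F, (∀ i j, D i j ∈ O) → ∀ j : Fin m, (j : ℕ) < n →
    (∀ j' < j, ∀ i : Fin m, low R j' = i → (R i j')⁻¹ ∈ O) → ∀ i, V i j ∈ O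

theorem IsPartialReduction.zero (D : Matrix (Fin m) (Fin m) F) : IsPartialReduction D 0 D 1 where
  eq_mul := by simp
  diag := by simp
  upper i j h := Matrix.one_apply_ne h.ne'
  initial _ _ _ := rfl
  reduced _ _ _ _ h := absurd h (by omega)
  graded g _ i j h := by
    by_contra hne
    exact h (Matrix.one_apply_ne fun hij => hne (by rw [hij]))
  integral _ _ _ h := absurd h (by omega)

/-- Only column `j` changes, so each invariant has to be checked there alone. Integrality of a
column asks for invertible pivots only in strictly earlier columns; the induction for 2 → 1 depends
on this. -/
theorem IsPartialReduction.succ {D R V : Matrix (Fin m) (Fin m) F} {j : Fin m}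
    (h : IsPartialReduction D j R V) :
    IsPartialReduction D (j + 1) (reduceColumn j R V).1 (reduceColumn j R V).2 := by
  have hcolR : ∀ b, b ≠ j → ∀ a, (reduceColumn j R V).1 a b = R a b :=
    fun b hb => (reduceColumn_apply_of_ne j R V hb).1
  have hcolV : ∀ b, b ≠ j → ∀ a, (reduceColumn j R V).2 a b = V a b :=
    fun b hb => (reduceColumn_apply_of_ne j R V hb).2
  have hlow : ∀ b, b ≠ j → low (reduceColumn j R V).1 b = low R b :=
    fun b hb => low_eq_of_col_eq (hcolR b hb)
  have hmul : (reduceColumn j R V).1 = D * (reduceColumn j R V).2 :=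
    reduceColumn_induction j (fun R' V' => R' = D * V')
      (fun R' V' i j' _ _ _ e => by rw [mul_subCol, ← e]) R V h.eq_mul
  have htri : (∀ b, (reduceColumn j R V).2 b b = 1) ∧
      ∀ a b, b < a → (reduceColumn j R V).2 a b = 0 := by
    refine reduceColumn_induction j (fun R' V' => (∀ b, V' b b = 1) ∧ ∀ a b, b < a → V' a b = 0)
      ?_ R V ⟨h.diag, h.upper⟩
    rintro R' V' i j' hj' - - ⟨h1, h2⟩
    refine ⟨fun b => ?_, fun a b hab => ?_⟩
    · by_cases hb : b = j
      · subst hb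
        rw [subCol_apply_self, h1, h2 _ _ hj', mul_zero, sub_zero]
      · rw [subCol_apply_of_ne _ hb, h1]
    · by_cases hb : b = j
      · subst hb
        rw [subCol_apply_self, h2 _ _ hab, h2 _ _ (hj'.trans hab), mul_zero, sub_zero]
      · rw [subCol_apply_of_ne _ hb, h2 _ _ hab]
  refine ⟨hmul, htri.1, htri.2, fun b hb a => ?_, fun i b b' hb' hb h1 => ?_, fun g hg => ?_,
    fun O hO b hb hunit => ?_⟩
  · rw [hcolV b (by rintro rfl; omega), h.initial b (by omega)]
  · by_cases e : b = j
    · subst e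
      exact reduceColumn_reduced b R V i b' hb' h1
    · have hbj : b < j := Fin.lt_def.mpr (by have := Fin.val_ne_of_ne e; omega)
      rw [hlow b e]
      rw [hlow b' (hb'.trans hbj).ne] at h1
      exact h.reduced i b b' hb' hbj h1
  · refine (reduceColumn_induction j (fun R' V' => R' = D * V' ∧ ∀ i j, V' i j ≠ 0 → g i = g j)
      ?_ R V ⟨h.eq_mul, h.graded g hg⟩).2
    rintro R' V' i j' - h1 h2 ⟨e, hV⟩
    refine ⟨by rw [mul_subCol, ← e], fun a b hab => ?_⟩
    by_cases hb : b = j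
    · subst hb
      rw [subCol_apply_self] at hab
      have hR : ∀ c d, R' c d ≠ 0 → g c = g d + 1 := by
        intro c d hcd
        rw [e] at hcd
        obtain ⟨x, hx, hx'⟩ := exists_ne_zero_of_mul_apply_ne_zero hcd
        rw [hg _ _ hx, hV _ _ hx']
      -- Both columns are nonzero in the pivot row, so columns `j'` and `b` have the same degree.
      have e1 := hR _ _ (low_eq_coe_iff.mp h1).1
      have e2 := hR _ _ (low_eq_coe_iff.mp h2).1
      by_cases hab' : V' a b = 0
      · have : V' a j' ≠ 0 := by
          rintro h0
          simp [hab', h0] at hab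
        have := hV _ _ this
        omega
      · exact hV _ _ hab'
    · rw [subCol_apply_of_ne _ hb] at hab
      exact hV _ _ hab
  · by_cases e : b = j
    · subst e
      have hint : ∀ b' < b, ∀ i, V i b' ∈ O := by
        intro b' hb'
        refine h.integral O hO b' hb' fun c hc i hi => ?_
        have hcb : c ≠ b := (hc.trans hb').ne
        rw [← hcolR c hcb]
        exact hunit c (hc.trans hb') i (by rw [hlow c hcb, hi])
      have hR : ∀ b' < b, ∀ i, R i b' ∈ O := fun b' hb' i => by
        rw [h.eq_mul]
        exact subring_mul_mem_apply hO (hint b' hb') i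
      -- The middle clause freezes the earlier columns during the loop, so the pivots divided by are
      -- the final ones, whose inverses lie in `O`.
      refine (reduceColumn_induction b (fun R' V' => R' = D * V' ∧
        (∀ b' < b, (∀ i, R' i b' = R i b') ∧ ∀ i, V' i b' = V i b') ∧ ∀ i, V' i b ∈ O)
        ?_ R V ⟨h.eq_mul, fun _ _ => ⟨fun _ => rfl, fun _ => rfl⟩, fun i => ?_⟩).2.2
      · rintro R' V' i j' hj' h1 h2 ⟨e, hc, hV⟩
        refine ⟨by rw [mul_subCol, ← e], fun b' hb' => ⟨fun a => ?_, fun a => ?_⟩, fun a => ?_⟩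
        · rw [subCol_apply_of_ne _ hb'.ne, (hc b' hb').1]
        · rw [subCol_apply_of_ne _ hb'.ne, (hc b' hb').2]
        · rw [subCol_apply_self, (hc j' hj').2, (hc j' hj').1, div_eq_mul_inv]
          have h3 : R' i b ∈ O := by
            rw [e]
            exact subring_mul_mem_apply hO hV i
          have h4 : (R i j')⁻¹ ∈ O := by
            rw [← hcolR j' hj'.ne]
            refine hunit j' hj' i ?_
            rw [hlow j' hj'.ne, ← low_eq_of_col_eq (hc j' hj').1, h1]
          exact O.sub_mem (hV a) (O.mul_mem (O.mul_mem h3 h4) (hint j' hj' a))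
      · rw [h.initial b le_rfl, Matrix.one_apply]
        split_ifs
        exacts [O.one_mem, O.zero_mem]
    · have hbj : b < j := Fin.lt_def.mpr (by have := Fin.val_ne_of_ne e; omega)
      intro i
      rw [hcolV b e]
      refine h.integral O hO b hbj (fun c hc a ha => ?_) i
      have hcj : c ≠ j := (hc.trans hbj).ne
      rw [← hcolR c hcj]
      exact hunit c hc a (by rw [hlow c hcj, ha])

theorem standardAlgorithm_isPartialReduction (D : Matrix (Fin m) (Fin m) F) :
    IsPartialReduction D m (standardAlgorithm D).1 (standardAlgorithm D).2 :=
  standardAlgorithm_induction D (IsPartialReduction D) (IsPartialReduction.zero D)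
    fun _ _ _ h => h.succ

end Algorithm

/-! ### Row reductions, the completed matrix `K` and the conjugate of `D`. -/

section RowReduction

variable {F : Type} [Field F] [DecidableEq F] {m : ℕ}

/-- `S = A * D` is a row reduction of `D`: `A` is upper unitriangular and the leading entries of
the nonzero rows of `S` lie in different columns. -/
structure IsRowReduction (D A S : Matrix (Fin m) (Fin m) F) : Prop where
  eq_mul : S = A * D
  diag : ∀ j, A j j = 1
  upper : ∀ i j, j < i → A i j = 0
  lead_inj : ∀ r r' i : Fin m, lead S r = i → lead S r' = i → r = r'

/-- The rows of `K` are the normalized nonzero rows of `S`, each placed at the index of its leading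
entry, and the remaining rows are those of `A`. -/
structure IsCompletion (A S K : Matrix (Fin m) (Fin m) F) : Prop where
  row_lead : ∀ r i : Fin m, lead S r = i → ∀ j, K i j = S r j / S r i
  row_of_forall_ne : ∀ i : Fin m, (∀ r, lead S r ≠ i) → ∀ j, K i j = A i j

/-- The matrix of the leading entries of the rows of `S`. -/
def leadMatrix (S : Matrix (Fin m) (Fin m) F) : Matrix (Fin m) (Fin m) F :=
  Matrix.of fun i j => if lead S i = j then S i j else 0

theorem leadMatrix_apply (S : Matrix (Fin m) (Fin m) F) (i j : Fin m) :
    leadMatrix S i j = if lead S i = j then S i j else 0 := rfl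

theorem leadMatrix_col_eq_zero_iff {S : Matrix (Fin m) (Fin m) F} {j : Fin m} :
    (∀ i, leadMatrix S i j = 0) ↔ ∀ i, lead S i ≠ j := by
  refine forall_congr' fun i => ?_
  rw [leadMatrix_apply]
  constructor
  · intro h h'
    rw [if_pos h'] at h
    exact (lead_eq_coe_iff.mp h').1 h
  · intro h
    rw [if_neg h]

theorem exists_lead_eq_of_apply_ne_zero {S : Matrix (Fin m) (Fin m) F} {r j : Fin m}
    (h : S r j ≠ 0) : ∃ i : Fin m, lead S r = i := by
  obtain ⟨i, hi⟩ := WithTop.ne_top_iff_exists.mp fun e => h (lead_eq_top_iff.mp e j)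
  exact ⟨i, hi.symm⟩

theorem upper_unitriangular_det {R : Type} [CommRing R] {K : Matrix (Fin m) (Fin m) R}
    (hd : ∀ j, K j j = 1) (hu : ∀ i j, j < i → K i j = 0) : K.det = 1 := by
  rw [Matrix.det_of_isUpperTriangular (fun i j h => hu i j h)]
  simp [hd]

/-- The inverse of an upper unitriangular matrix is upper unitriangular. -/
theorem upper_unitriangular_inv {R : Type} [CommRing R] {K : Matrix (Fin m) (Fin m) R}
    (hd : ∀ j, K j j = 1) (hu : ∀ i j, j < i → K i j = 0) :
    (∀ j, K⁻¹ j j = 1) ∧ ∀ i j, j < i → K⁻¹ i j = 0 := by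
  have hdet : IsUnit K.det := by rw [upper_unitriangular_det hd hu]; exact isUnit_one
  have : Invertible K := Matrix.invertibleOfIsUnitDet K hdet
  have hi : ∀ i j, j < i → K⁻¹ i j = 0 := fun i j h =>
    Matrix.blockTriangular_inv_of_blockTriangular (M := K) (b := id) (fun i j h => hu i j h) h
  refine ⟨fun j => ?_, hi⟩
  have h1 : (K * K⁻¹) j j = 1 := by rw [Matrix.mul_nonsing_inv _ hdet, Matrix.one_apply_eq]
  rw [Matrix.mul_apply, Finset.sum_eq_single j, hd, one_mul] at h1
  · exact h1
  · intro b _ hb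
    rcases lt_or_gt_of_ne hb with h | h
    · rw [hu _ _ h, zero_mul]
    · rw [hi _ _ h, mul_zero]
  · simp

namespace IsRowReduction

variable {D A S K : Matrix (Fin m) (Fin m) F}

/-- Among the nonzero rows that occur in the relation, take the one with leftmost lead: in that
column it contributes the only nonzero term. So a relation involves zero rows only. -/
theorem eq_zero_of_combination (h : IsRowReduction D A S) {c : Fin m → F}
    (hc : Matrix.vecMul c S = 0) {a : Fin m} (ha : c a ≠ 0) (j : Fin m) : S a j = 0 := by
  classical
  by_contra hne
  obtain ⟨l₀, hl₀⟩ := exists_lead_eq_of_apply_ne_zero hne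
  have hex : ∃ l : Fin m, ∃ b, c b ≠ 0 ∧ lead S b = l := ⟨l₀, a, ha, hl₀⟩
  obtain ⟨l, ⟨b, hb, hbl⟩, hmin⟩ := WellFounded.has_min (wellFounded_lt (α := Fin m))
    {l | ∃ b, c b ≠ 0 ∧ lead S b = l} hex
  have := congrFun hc l
  rw [Matrix.vecMul, dotProduct, Finset.sum_eq_single b] at this
  · exact mul_ne_zero hb (lead_eq_coe_iff.mp hbl).1 this
  · intro b' _ hb'
    by_contra hp
    obtain ⟨l', hl'⟩ := exists_lead_eq_of_apply_ne_zero (right_ne_zero_of_mul hp)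
    have h1 : ¬ l' < l := hmin l' ⟨b', left_ne_zero_of_mul hp, hl'⟩
    have h2 : ¬ l < l' := fun hlt => right_ne_zero_of_mul hp ((lead_eq_coe_iff.mp hl').2 _ hlt)
    obtain rfl : l' = l := le_antisymm (not_lt.mp h2) (not_lt.mp h1)
    exact hb' (h.lead_inj _ _ _ hl' hbl)
  · simp

theorem inv_mul_self (h : IsRowReduction D A S) : A⁻¹ * A = 1 :=
  Matrix.nonsing_inv_mul _ (by rw [upper_unitriangular_det h.diag h.upper]; exact isUnit_one)

/-- If a row of `S` has its leading entry in column `i`, then row `i` of `S` vanishes. -/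
theorem row_eq_zero_of_lead (h : IsRowReduction D A S) (hD : D * D = 0) {r i : Fin m}
    (hr : lead S r = i) (j : Fin m) : S i j = 0 := by
  -- `S * A⁻¹ * S = A * D * D = 0`, so this row is a relation among the rows of `S`. Its coefficient
  -- at `i` is the leading entry `S r i`, since `A⁻¹` is upper unitriangular.
  refine h.eq_zero_of_combination (c := (S * A⁻¹) r) ?_ ?_ j
  · have : S * A⁻¹ * S = 0 := by
      rw [h.eq_mul, Matrix.mul_assoc (A * D), ← Matrix.mul_assoc A⁻¹, h.inv_mul_self,
        Matrix.one_mul, Matrix.mul_assoc, hD, Matrix.mul_zero]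
    exact congrFun this r
  · obtain ⟨hne, hlt⟩ := lead_eq_coe_iff.mp hr
    obtain ⟨hd, hu⟩ := upper_unitriangular_inv h.diag h.upper
    rw [Matrix.mul_apply, Finset.sum_eq_single i, hd, mul_one]
    · exact hne
    · intro b _ hb
      rcases lt_or_gt_of_ne hb with h' | h'
      · rw [hlt _ h', zero_mul]
      · rw [hu _ _ h', mul_zero]
    · simp

theorem completion_diag (h : IsRowReduction D A S) (hK : IsCompletion A S K) (j : Fin m) :
    K j j = 1 := by
  by_cases hj : ∃ r, lead S r = j
  · obtain ⟨r, hr⟩ := hj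
    rw [hK.row_lead r j hr, div_self (lead_eq_coe_iff.mp hr).1]
  · rw [hK.row_of_forall_ne j (not_exists.mp hj), h.diag]

theorem completion_upper (h : IsRowReduction D A S) (hK : IsCompletion A S K) (i j : Fin m)
    (hij : j < i) : K i j = 0 := by
  by_cases hj : ∃ r, lead S r = i
  · obtain ⟨r, hr⟩ := hj
    rw [hK.row_lead r i hr, (lead_eq_coe_iff.mp hr).2 j hij, zero_div]
  · rw [hK.row_of_forall_ne i (not_exists.mp hj), h.upper _ _ hij]

/-- If `i` is a leading column, row `i` of `K` is a multiple of a row of `A * D`, which `D` kills,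
and row `i` of `S` vanishes. Otherwise row `i` of `K * D` is row `i` of `S`: zero, or its leading
entry times the normalized row stored in `K`. -/
theorem completion_mul (h : IsRowReduction D A S) (hD : D * D = 0) (hK : IsCompletion A S K) :
    K * D = leadMatrix S * K := by
  ext i j
  by_cases hi : ∃ r, lead S r = i
  · obtain ⟨r, hr⟩ := hi
    have h0 : ∀ a, S i a = 0 := h.row_eq_zero_of_lead hD hr
    have hSD : S * D = 0 := by rw [h.eq_mul, Matrix.mul_assoc, hD, Matrix.mul_zero]
    have h1 : (K * D) i j = (S * D) r j / S r i := by
      simp only [Matrix.mul_apply, hK.row_lead r i hr, Finset.sum_div]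
      exact Finset.sum_congr rfl fun a _ => by ring
    rw [h1, hSD, Matrix.zero_apply, zero_div, Matrix.mul_apply]
    refine (Finset.sum_eq_zero fun a _ => ?_).symm
    rw [leadMatrix_apply]
    simp [h0]
  · have h1 : (K * D) i j = S i j := by
      simp only [h.eq_mul, Matrix.mul_apply, hK.row_of_forall_ne i (not_exists.mp hi)]
    rw [h1, Matrix.mul_apply]
    by_cases h0 : ∃ l : Fin m, lead S i = l
    · obtain ⟨l, hl⟩ := h0
      rw [Finset.sum_eq_single l, leadMatrix_apply, if_pos hl, hK.row_lead i l hl,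
        mul_div_cancel₀ _ (lead_eq_coe_iff.mp hl).1]
      · intro b _ hb
        rw [leadMatrix_apply, if_neg, zero_mul]
        rw [hl]
        exact fun e => hb (WithTop.coe_injective e).symm
      · simp
    · have : ∀ a, S i a = 0 := by
        intro a
        by_contra hne
        exact h0 (exists_lead_eq_of_apply_ne_zero hne)
      rw [this]
      refine (Finset.sum_eq_zero fun a _ => ?_).symm
      rw [leadMatrix_apply]
      simp [this]

theorem completion_mul_inv_self (h : IsRowReduction D A S) (hK : IsCompletion A S K) :
    K * K⁻¹ = 1 :=
  Matrix.mul_nonsing_inv _ (by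
    rw [upper_unitriangular_det (h.completion_diag hK) (h.completion_upper hK)]; exact isUnit_one)

theorem completion_inv_mul_self (h : IsRowReduction D A S) (hK : IsCompletion A S K) :
    K⁻¹ * K = 1 :=
  Matrix.nonsing_inv_mul _ (by
    rw [upper_unitriangular_det (h.completion_diag hK) (h.completion_upper hK)]; exact isUnit_one)

theorem completion_conj (h : IsRowReduction D A S) (hD : D * D = 0) (hK : IsCompletion A S K) :
    K * D * K⁻¹ = leadMatrix S := by
  rw [h.completion_mul hD hK, Matrix.mul_assoc, h.completion_mul_inv_self hK, Matrix.mul_one]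

/-- Read by columns, this says that the differential sends each column of `K⁻¹` to zero or to a
multiple of a single other column. -/
theorem mul_completion_inv (h : IsRowReduction D A S) (hD : D * D = 0)
    (hK : IsCompletion A S K) : D * K⁻¹ = K⁻¹ * leadMatrix S := by
  rw [← h.completion_conj hD hK, ← Matrix.mul_assoc, ← Matrix.mul_assoc,
    h.completion_inv_mul_self hK, Matrix.one_mul]

/-- Row `r` of `S` is supported in degree `g r + 1`, its leading column included; moving it to the
index of that column makes it homogeneous. -/
theorem completion_graded (h : IsRowReduction D A S) (hK : IsCompletion A S K) {g : Fin m → ℤ}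
    (hD : ∀ i j, D i j ≠ 0 → g j = g i + 1) (hA : ∀ i j, A i j ≠ 0 → g i = g j) (i j : Fin m)
    (hij : K i j ≠ 0) : g i = g j := by
  by_cases hi : ∃ r, lead S r = i
  · obtain ⟨r, hr⟩ := hi
    have hS : ∀ a, S r a ≠ 0 → g a = g r + 1 := by
      intro a ha
      rw [h.eq_mul] at ha
      obtain ⟨x, hx, hx'⟩ := exists_ne_zero_of_mul_apply_ne_zero ha
      rw [hD _ _ hx', hA _ _ hx]
    rw [hK.row_lead r i hr] at hij
    rw [hS i (lead_eq_coe_iff.mp hr).1, hS j (div_ne_zero_iff.mp hij).1]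
  · rw [hK.row_of_forall_ne i (not_exists.mp hi)] at hij
    exact hA _ _ hij

theorem completion_mem_subring (h : IsRowReduction D A S) (hK : IsCompletion A S K)
    {O : Subring F} (hD : ∀ i j, D i j ∈ O) (hA : ∀ i j, A i j ∈ O)
    (hS : ∀ r i : Fin m, lead S r = i → (S r i)⁻¹ ∈ O) (i j : Fin m) : K i j ∈ O := by
  by_cases hi : ∃ r, lead S r = i
  · obtain ⟨r, hr⟩ := hi
    rw [hK.row_lead r i hr, div_eq_mul_inv, h.eq_mul]
    refine O.mul_mem ?_ (by simpa only [← h.eq_mul] using hS r i hr)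
    rw [Matrix.mul_apply]
    exact Subring.sum_mem _ fun a _ => O.mul_mem (hA _ _) (hD _ _)
  · rw [hK.row_of_forall_ne i (not_exists.mp hi)]
    exact hA _ _

end IsRowReduction

end RowReduction

/-- The inverse of an invertible matrix that respects a grading of the indices respects it. -/
theorem graded_inv {m : ℕ} {K : Matrix (Fin m) (Fin m) ℚ} (h1 : K * K⁻¹ = 1) (h2 : K⁻¹ * K = 1)
    {g : Fin m → ℤ} (hK : ∀ i j, K i j ≠ 0 → g i = g j) (i j : Fin m) (hij : K⁻¹ i j ≠ 0) :
    g i = g j := by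
  -- Respecting the grading amounts to commuting with the diagonal matrix of degrees, a property
  -- that passes to the inverse.
  have hc : K * Matrix.diagonal (fun i => (g i : ℚ)) = Matrix.diagonal (fun i => (g i : ℚ)) * K := by
    ext a b
    rw [Matrix.mul_diagonal, Matrix.diagonal_mul]
    by_cases h : K a b = 0
    · simp [h]
    · rw [hK _ _ h, mul_comm]
  have hc' : K⁻¹ * Matrix.diagonal (fun i => (g i : ℚ)) =
      Matrix.diagonal (fun i => (g i : ℚ)) * K⁻¹ := by
    calc _ = K⁻¹ * (Matrix.diagonal (fun i => (g i : ℚ)) * K) * K⁻¹ := by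
          rw [Matrix.mul_assoc, Matrix.mul_assoc, h1, Matrix.mul_one]
      _ = _ := by rw [← hc, ← Matrix.mul_assoc, h2, Matrix.one_mul]
  have := congrFun (congrFun hc' i) j
  rw [Matrix.mul_diagonal, Matrix.diagonal_mul, mul_comm] at this
  exact_mod_cast (mul_right_cancel₀ hij this).symm

/-! ### The algorithm's output as a row reduction of the boundary matrix. -/

namespace StandardFormChainComplex

variable {m : ℕ} (X : StandardFormChainComplex m)

theorem boundaryMatrix_apply (i j : Fin m) :
    X.boundaryMatrix i j = ((X.bd (Pi.single j 1) i : ℤ) : ℚ) := by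
  simp [boundaryMatrix, LinearMap.toMatrix'_apply]

theorem boundaryMatrix_mul_self : X.boundaryMatrix * X.boundaryMatrix = 0 := by
  have h : LinearMap.toMatrix' X.bd * LinearMap.toMatrix' X.bd = 0 := by
    rw [← LinearMap.toMatrix'_comp, X.bd_bd, map_zero]
  have h2 := Matrix.map_mul (L := LinearMap.toMatrix' X.bd) (M := LinearMap.toMatrix' X.bd)
    (f := Int.castRingHom ℚ)
  rw [h] at h2
  refine Eq.trans h2.symm ?_
  ext
  simp

theorem isPartialReduction_hat :
    IsPartialReduction (antiTranspose X.boundaryMatrix) m X.Rhat X.Vhat :=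
  standardAlgorithm_isPartialReduction _

theorem isRowReduction_hat :
    IsRowReduction X.boundaryMatrix (antiTranspose X.Vhat) (antiTranspose X.Rhat) where
  eq_mul := by
    rw [X.isPartialReduction_hat.eq_mul, antiTranspose_mul, antiTranspose_antiTranspose]
  diag j := X.isPartialReduction_hat.diag _
  upper i j h := X.isPartialReduction_hat.upper _ _ (Fin.rev_lt_rev.mpr h)
  lead_inj r r' i h h' := by
    rw [lead_antiTranspose] at h h'
    rw [← Fin.rev_inj]
    rcases lt_trichotomy r.rev r'.rev with hlt | heq | hlt
    · exact absurd h' (X.isPartialReduction_hat.reduced _ _ _ hlt (Fin.is_lt _) h)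
    · exact heq
    · exact absurd h (X.isPartialReduction_hat.reduced _ _ _ hlt (Fin.is_lt _) h')

theorem isCompletion_matK : IsCompletion (antiTranspose X.Vhat) (antiTranspose X.Rhat) X.matK where
  row_lead r i h j := by
    have hex : ∃ r : Fin m, lead (antiTranspose X.Rhat) r = i := ⟨r, h⟩
    have hr : hex.choose = r := X.isRowReduction_hat.lead_inj _ _ _ hex.choose_spec h
    simp only [matK, Matrix.of_apply, dif_pos hex, hr]
  row_of_forall_ne i h j := by
    have hex : ¬ ∃ r : Fin m, lead (antiTranspose X.Rhat) r = i := not_exists.mpr h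
    simp only [matK, Matrix.of_apply, dif_neg hex]

theorem matM_eq : X.matM = leadMatrix (antiTranspose X.Rhat) :=
  X.isRowReduction_hat.completion_conj X.boundaryMatrix_mul_self X.isCompletion_matK

end StandardFormChainComplex

/-- A family of submodules that are separated by linear maps, the `i`th of which is injective on the
`i`th submodule and vanishes on the others, is independent. -/
theorem iSupIndep_of_separating {R M ι : Type} [CommRing R] [AddCommGroup M] [Module R M]
    {N : ι → Type} [∀ i, AddCommGroup (N i)] [∀ i, Module R (N i)] (p : ι → Submodule R M)
    (φ : ∀ i, M →ₗ[R] N i) (h0 : ∀ i j, j ≠ i → ∀ x ∈ p j, φ i x = 0)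
    (h1 : ∀ i, ∀ x ∈ p i, φ i x = 0 → x = 0) : iSupIndep p := by
  intro i
  rw [Submodule.disjoint_def]
  intro x hx hx'
  refine h1 i x hx ?_
  have : (⨆ j, ⨆ (_ : j ≠ i), p j) ≤ LinearMap.ker (φ i) :=
    iSup₂_le fun j hj y hy => h0 i j hj y hy
  exact this hx'

/-! ### Principal submodules, interval sums and torsion-freeness. -/

namespace PersistenceModule

variable {R : Type} [CommRing R] {m : ℕ}

theorem mem_intervalObj {b d i : ℕ} (h : b ≤ i ∧ i < d) (x : R) : x ∈ intervalObj R b d i := by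
  simp [intervalObj, h]

theorem eq_zero_of_mem_intervalObj {b d i : ℕ} (h : ¬ (b ≤ i ∧ i < d)) {x : R}
    (hx : x ∈ intervalObj R b d i) : x = 0 := by
  simpa [intervalObj, h] using hx

theorem map_self_apply (f : PersistenceModule R m) {p : Fin (m + 1)} (g : p ⟶ p) (x : f.obj p) :
    (f.map g).hom x = x := by
  rw [Subsingleton.elim g (𝟙 p), f.map_id]
  rfl

theorem map_map_apply (f : PersistenceModule R m) {p q r : Fin (m + 1)} (g : p ⟶ q) (g' : q ⟶ r)
    (g'' : p ⟶ r) (x : f.obj p) : (f.map g').hom ((f.map g).hom x) = (f.map g'').hom x := by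
  rw [Subsingleton.elim g'' (g ≫ g'), f.map_comp]
  rfl

namespace Sub

variable {f : PersistenceModule R m}

theorem generatedBy_carrier_of_le {p q : Fin (m + 1)} (x : f.obj p) (h : p ≤ q) :
    (generatedBy p x).carrier q = Submodule.span R {(f.map (homOfLE h)).hom x} := by
  apply le_antisymm
  -- Images of `x` along all morphisms; the set is empty where `p ≤ q` fails, so no case split is
  -- needed.
  · let h₀ : Sub f :=
      { carrier := fun q => Submodule.span R {y | ∃ g : p ⟶ q, y = (f.map g).hom x}
        map_mem := by
          intro q q' g y hy
          induction hy using Submodule.span_induction with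
          | mem y hy =>
            obtain ⟨g', rfl⟩ := hy
            exact Submodule.subset_span ⟨g' ≫ g, map_map_apply f _ _ _ _⟩
          | zero => simp
          | add y z _ _ hy hz => rw [map_add]; exact Submodule.add_mem _ hy hz
          | smul c y _ hy => rw [map_smul]; exact Submodule.smul_mem _ c hy }
    have hx : x ∈ h₀.carrier p := Submodule.subset_span ⟨𝟙 p, (map_self_apply f _ x).symm⟩
    refine (iInf_le _ (⟨h₀, hx⟩ : {h : Sub f // x ∈ h.carrier p})).trans ?_
    refine Submodule.span_mono ?_
    rintro y ⟨g, rfl⟩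
    rw [Set.mem_singleton_iff, Subsingleton.elim g (homOfLE h)]
  · rw [Submodule.span_le, Set.singleton_subset_iff]
    refine (Submodule.mem_iInf _).mpr fun h' => h'.1.map_mem _ _ h'.2

/-- The submodule that is everything from `p` on and zero elsewhere already contains `x`. -/
theorem generatedBy_carrier_of_not_le {p q : Fin (m + 1)} (x : f.obj p) (h : ¬ p ≤ q) :
    (generatedBy p x).carrier q = ⊥ := by
  rw [eq_bot_iff]
  let h₀ : Sub f :=
    { carrier := fun q => if p ≤ q then ⊤ else ⊥
      map_mem := by
        intro q q' g y hy
        by_cases hq' : p ≤ q'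
        · simp [hq']
        · have hq : ¬ p ≤ q := fun hq => hq' (hq.trans (leOfHom g))
          rw [if_neg hq, Submodule.mem_bot] at hy
          simp [hy] }
  have hx : x ∈ h₀.carrier p := by simp [h₀]
  refine (iInf_le _ (⟨h₀, hx⟩ : {h : Sub f // x ∈ h.carrier p})).trans ?_
  simp [h₀, h]

/-- An element that is torsion-free until it dies at `d` generates an interval module. -/
theorem generatedBy_isInterval {p : Fin (m + 1)} (x : f.obj p) (d : ℕ) (hpd : (p : ℕ) < d)
    (hd : d ≤ m + 1)
    (alive : ∀ (q : Fin (m + 1)) (h : p ≤ q), (q : ℕ) < d → ∀ c : R,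
      c • (f.map (homOfLE h)).hom x = 0 → c = 0)
    (dead : ∀ (q : Fin (m + 1)) (h : p ≤ q), d ≤ q → (f.map (homOfLE h)).hom x = 0) :
    (generatedBy p x).toModule.IsInterval := by
  classical
  refine ⟨p, d, hpd, hd, ⟨Iso.symm ?_⟩⟩
  let y : ∀ q, f.obj q := fun q => if h : p ≤ q then (f.map (homOfLE h)).hom x else 0
  have hy : ∀ q, y q ∈ (generatedBy p x).carrier q := by
    intro q
    by_cases h : p ≤ q
    · simp only [y, dif_pos h, generatedBy_carrier_of_le x h]
      exact Submodule.mem_span_singleton_self _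
    · simp only [y, dif_neg h]
      exact Submodule.zero_mem _
  -- Multiplication of `y q` by scalars: injective by `alive`, surjective because the generated
  -- submodule is cyclic or zero at each index.
  let φ : ∀ q : Fin (m + 1), intervalObj R p d q →ₗ[R] (generatedBy p x).carrier q := fun q =>
    (LinearMap.toSpanSingleton R ((generatedBy p x).carrier q) ⟨y q, hy q⟩) ∘ₗ
      (intervalObj R p d q).subtype
  have hφ : ∀ q c, (φ q c : f.obj q) = c.1 • y q := fun q c => rfl
  have hint : ∀ (q : Fin (m + 1)) (c : intervalObj R p d q), ¬ ((p : ℕ) ≤ q ∧ (q : ℕ) < d) →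
      c.1 = 0 := fun q c hq => eq_zero_of_mem_intervalObj hq c.2
  have hbij : ∀ q, Function.Bijective (φ q) := by
    intro q
    constructor
    · rw [← LinearMap.ker_eq_bot, eq_bot_iff]
      intro c hc
      rw [LinearMap.mem_ker, Subtype.ext_iff, hφ] at hc
      rw [Submodule.mem_bot, Subtype.ext_iff]
      by_cases hq : (p : ℕ) ≤ q ∧ (q : ℕ) < d
      · have hpq : p ≤ q := hq.1
        simp only [y, dif_pos hpq] at hc
        exact alive q hpq hq.2 _ hc
      · exact hint q c hq
    · rintro ⟨z, hz⟩
      by_cases hpq : p ≤ q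
      · have hz' := hz
        rw [generatedBy_carrier_of_le x hpq, Submodule.mem_span_singleton] at hz'
        obtain ⟨c, hc⟩ := hz'
        by_cases hq : (q : ℕ) < d
        · refine ⟨⟨c, mem_intervalObj ⟨hpq, hq⟩ c⟩, ?_⟩
          rw [Subtype.ext_iff, hφ]
          simp only [y, dif_pos hpq, hc]
        · refine ⟨0, ?_⟩
          rw [map_zero, Subtype.ext_iff]
          rw [dead q hpq (not_lt.mp hq), smul_zero] at hc
          exact hc
      · refine ⟨0, ?_⟩
        rw [generatedBy_carrier_of_not_le x hpq, Submodule.mem_bot] at hz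
        rw [map_zero, Subtype.ext_iff]
        exact hz.symm
  refine NatIso.ofComponents (fun q => (LinearEquiv.ofBijective (φ q) (hbij q)).toModuleIso) ?_
  intro q q' g
  apply ModuleCat.hom_ext
  refine LinearMap.ext fun c => Subtype.ext ?_
  suffices key : ∀ c : intervalObj R p d q,
      (if (p : ℕ) ≤ q' ∧ (q' : ℕ) < d then c.1 else 0) • y q' = (f.map g).hom (c.1 • y q) from key c
  intro c
  rw [map_smul]
  by_cases hpq : p ≤ q
  · have hpq' : p ≤ q' := hpq.trans (leOfHom g)
    have e : (f.map g).hom (y q) = y q' := by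
      simp only [y, dif_pos hpq, dif_pos hpq']
      exact map_map_apply f _ _ _ _
    rw [e]
    by_cases hq' : (q' : ℕ) < d
    · rw [if_pos ⟨hpq', hq'⟩]
    · have : y q' = 0 := by
        simp only [y, dif_pos hpq']
        exact dead q' hpq' (not_lt.mp hq')
      rw [this, smul_zero, smul_zero]
  · rw [hint q c (fun h => hpq h.1), ite_self, zero_smul, zero_smul]

end Sub

/-- A finite internal direct sum of interval modules splits into intervals. -/
theorem SplitsIntoIntervals.of_isInternalDirectSum {f : PersistenceModule R m} {ι : Type}
    [DecidableEq ι] [Finite ι] (h : ι → Sub f) (hint : IsInternalDirectSum h)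
    (hI : ∀ i, (h i).toModule.IsInterval) : f.SplitsIntoIntervals := by
  classical
  obtain ⟨r, ⟨e⟩⟩ := Finite.exists_equiv_fin ι
  choose b d hbd hd iso using hI
  refine ⟨r, fun i => b (e.symm i), fun i => d (e.symm i), fun i => ⟨hbd _, hd _⟩, ⟨Iso.symm ?_⟩⟩
  let α : ∀ i, interval R m (b i) (d i) ⟶ (h i).toModule := fun i => (iso i).some.inv
  have hα : ∀ i p, Function.Bijective ((α i).app p).hom := fun i p => by
    have : IsIso ((α i).app p) := inferInstance
    exact ConcreteCategory.bijective_of_isIso ((α i).app p)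
  let s : ∀ (i : Fin r) (p : Fin (m + 1)),
      (interval R m (b (e.symm i)) (d (e.symm i))).obj p →ₗ[R] f.obj p := fun i p =>
    ((h (e.symm i)).carrier p).subtype ∘ₗ ((α (e.symm i)).app p).hom
  let φ : ∀ p, (DirectSum (Fin r) fun i =>
      (interval R m (b (e.symm i)) (d (e.symm i))).obj p) →ₗ[R] f.obj p := fun p =>
    DirectSum.toModule R (Fin r) (f.obj p) fun i => s i p
  have hφ : ∀ p x, φ p x = ∑ i, s i p (x i) := by
    intro p x
    conv_lhs => rw [← DirectSum.sum_univ_of x]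
    rw [map_sum]
    refine Finset.sum_congr rfl fun i _ => ?_
    exact DirectSum.toModule_lof R
      (M := fun i => (interval R m (b (e.symm i)) (d (e.symm i))).obj p) i (x i)
  have hbij : ∀ p, Function.Bijective (φ p) := by
    intro p
    have hp := hint p
    constructor
    · rw [← LinearMap.ker_eq_bot, eq_bot_iff]
      intro x hx
      rw [LinearMap.mem_ker, hφ] at hx
      have hinj := (hp.1)
      -- The image of `x` in the sum of the submodules, where injectivity of the internal sum
      -- applies.
      let y : DirectSum ι fun i => (h i).carrier p :=
        ∑ i, DirectSum.of (fun i => (h i).carrier p) (e.symm i)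
          (((α (e.symm i)).app p).hom (x i))
      have hy : y = 0 := by
        apply hinj
        rw [map_zero, map_sum, ← hx]
        refine Finset.sum_congr rfl fun i _ => ?_
        exact DirectSum.coeAddMonoidHom_of _ _ _
      rw [Submodule.mem_bot]
      refine DFinsupp.ext fun i => ?_
      have hi : y (e.symm i) = ((α (e.symm i)).app p).hom (x i) := by
        simp only [y]
        rw [DFinsupp.finsetSum_apply, Finset.sum_eq_single i]
        · exact DirectSum.of_eq_same _ _
        · intro j _ hj
          exact DirectSum.of_eq_of_ne _ _ _ (fun hji => hj (e.symm.injective hji).symm)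
        · simp
      apply (hα (e.symm i) p).1
      exact (hi.symm.trans (congrArg (fun v => v (e.symm i)) hy)).trans
        (map_zero ((α (e.symm i)).app p).hom).symm
    · intro z
      obtain ⟨y, rfl⟩ := hp.2 z
      induction y using DirectSum.induction_on with
      | zero => exact ⟨0, by simp⟩
      | of i y =>
        obtain ⟨x, hx⟩ := (hα i p).2 y
        obtain ⟨j, rfl⟩ := e.symm.surjective i
        refine ⟨DirectSum.lof R _ (fun i => (interval R m (b (e.symm i)) (d (e.symm i))).obj p)
          j x, ?_⟩
        refine (DirectSum.toModule_lof R
          (M := fun i => (interval R m (b (e.symm i)) (d (e.symm i))).obj p) j x).trans ?_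
        refine Eq.trans ?_ (DirectSum.coeAddMonoidHom_of _ _ _).symm
        exact congrArg Subtype.val hx
      | add y y' hy hy' =>
        obtain ⟨x, hx⟩ := hy
        obtain ⟨x', hx'⟩ := hy'
        exact ⟨x + x', by rw [map_add, map_add, hx, hx']⟩
  refine NatIso.ofComponents (fun p => (LinearEquiv.ofBijective (φ p) (hbij p)).toModuleIso) ?_
  intro p q g
  apply ModuleCat.hom_ext
  refine LinearMap.ext fun x => ?_
  suffices key : ∀ x, φ q (DirectSum.lmap (fun i =>
      ((interval R m (b (e.symm i)) (d (e.symm i))).map g).hom) x) = (f.map g).hom (φ p x) from key x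
  intro x
  refine (hφ q _).trans (Eq.trans ?_ (congrArg (f.map g).hom (hφ p x)).symm)
  rw [map_sum]
  refine Finset.sum_congr rfl fun i _ => ?_
  have := congrArg (fun k => k.hom (x i)) ((α (e.symm i)).naturality g)
  exact congrArg Subtype.val this

theorem eq_zero_of_smul_eq_zero_interval {b d : ℕ} {p : Fin (m + 1)} [IsDomain R] {n : R}
    (hn : n ≠ 0) (x : (interval R m b d).obj p) (h : n • x = 0) : x = 0 := by
  have h' : n * (show intervalObj R b d p from x).1 = 0 := congrArg Subtype.val h
  exact Subtype.ext ((mul_eq_zero.mp h').resolve_left hn)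

/-- The cokernels of the structure maps of an interval module are torsion-free. -/
theorem exists_map_eq_of_smul_eq_map_interval {b d : ℕ} {p q : Fin (m + 1)} (g : p ⟶ q)
    [IsDomain R] {n : R} (hn : n ≠ 0) (x : (interval R m b d).obj q)
    (y : (interval R m b d).obj p) (h : n • x = ((interval R m b d).map g).hom y) :
    ∃ y', x = ((interval R m b d).map g).hom y' := by
  by_cases hp : b ≤ p ∧ (p : ℕ) < d
  -- The interval is alive at `p`, so the scalar `x` itself is available there.
  · refine ⟨⟨x.1, mem_intervalObj hp _⟩, Subtype.ext ?_⟩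
    change x.1 = if b ≤ q ∧ (q : ℕ) < d then x.1 else 0
    split_ifs with hq
    · rfl
    · exact eq_zero_of_mem_intervalObj hq x.2
  · have hy : y = 0 := Subtype.ext (eq_zero_of_mem_intervalObj hp y.2)
    rw [hy, map_zero] at h
    exact ⟨0, by rw [map_zero]; exact eq_zero_of_smul_eq_zero_interval hn x h⟩

theorem SplitsIntoIntervals.eq_zero_of_smul_eq_zero [IsDomain R] {f : PersistenceModule R m}
    (hf : f.SplitsIntoIntervals) {p : Fin (m + 1)} {n : R} (hn : n ≠ 0) (x : f.obj p)
    (h : n • x = 0) : x = 0 := by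
  obtain ⟨r, b, d, -, ⟨e⟩⟩ := hf
  have hinj : Function.Injective (e.hom.app p).hom :=
    (ConcreteCategory.bijective_of_isIso (e.hom.app p)).1
  apply hinj
  rw [map_zero]
  have h' : n • (e.hom.app p).hom x = 0 := by rw [← map_smul, h, map_zero]
  refine DFinsupp.ext fun i => ?_
  exact eq_zero_of_smul_eq_zero_interval hn _ (congrArg (fun z : DirectSum (Fin r) fun i =>
    (interval R m (b i) (d i)).obj p => z i) h')

/-- Cokernels of structure maps are torsion-free: preimages are found in each interval and
reassembled. -/
theorem SplitsIntoIntervals.exists_map_eq_of_smul_eq_map [IsDomain R] {f : PersistenceModule R m}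
    (hf : f.SplitsIntoIntervals) {p q : Fin (m + 1)} (g : p ⟶ q) {n : R} (hn : n ≠ 0)
    (x : f.obj q) (y : f.obj p) (h : n • x = (f.map g).hom y) :
    ∃ y', x = (f.map g).hom y' := by
  classical
  obtain ⟨r, b, d, -, ⟨e⟩⟩ := hf
  have hinj : Function.Injective (e.hom.app q).hom :=
    (ConcreteCategory.bijective_of_isIso (e.hom.app q)).1
  have hnat : ∀ z, (e.hom.app q).hom ((f.map g).hom z) =
      ((directSum fun i => interval R m (b i) (d i)).map g).hom ((e.hom.app p).hom z) :=
    fun z => congrArg (fun k => k.hom z) (e.hom.naturality g)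
  have h' : n • (e.hom.app q).hom x =
      ((directSum fun i => interval R m (b i) (d i)).map g).hom ((e.hom.app p).hom y) := by
    rw [← map_smul, h, hnat]
  let x' : DirectSum (Fin r) fun i => (interval R m (b i) (d i)).obj q := (e.hom.app q).hom x
  let y' : DirectSum (Fin r) fun i => (interval R m (b i) (d i)).obj p := (e.hom.app p).hom y
  have hi : ∀ i, ∃ w, x' i = ((interval R m (b i) (d i)).map g).hom w := fun i =>
    exists_map_eq_of_smul_eq_map_interval g hn (x' i) (y' i)
      (congrArg (fun z : DirectSum (Fin r) fun i => (interval R m (b i) (d i)).obj q => z i) h')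
  choose w hw using hi
  obtain ⟨z, hz⟩ := (ConcreteCategory.bijective_of_isIso (e.hom.app p)).2
    (show DirectSum (Fin r) fun i => (interval R m (b i) (d i)).obj p from
      DFinsupp.equivFunOnFintype.symm w)
  refine ⟨z, hinj ?_⟩
  rw [hnat]
  refine DFinsupp.ext fun i => (hw i).trans ?_
  exact congrArg (fun v : DirectSum (Fin r) fun i => (interval R m (b i) (d i)).obj p =>
    ((interval R m (b i) (d i)).map g).hom (v i)) hz.symm

end PersistenceModule

theorem mem_canonicalFiltration_iff {m : ℕ} {p : Fin (m + 1)} {x : Fin m → ℤ} :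
    x ∈ canonicalFiltration m p ↔ ∀ i : Fin m, (p : ℕ) ≤ i → x i = 0 := by
  constructor
  · intro hx i hi
    induction hx using Submodule.span_induction with
    | mem y hy =>
      obtain ⟨j, hj, rfl⟩ := hy
      exact Pi.single_eq_of_ne (by rintro rfl; omega) _
    | zero => rfl
    | add y z _ _ hy hz => rw [Pi.add_apply, hy, hz, add_zero]
    | smul c y _ hy => rw [Pi.smul_apply, hy, smul_zero]
  · intro h
    rw [← Finset.univ_sum_single x]
    refine Submodule.sum_mem _ fun i _ => ?_
    by_cases hi : (p : ℕ) ≤ i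
    · rw [h i hi, Pi.single_zero]
      exact Submodule.zero_mem _
    · have : (Pi.single i (x i) : Fin m → ℤ) = x i • Pi.single i 1 := by
        rw [← Pi.single_smul, smul_eq_mul, mul_one]
      rw [this]
      exact Submodule.smul_mem _ _ (Submodule.subset_span ⟨i, not_le.mp hi, rfl⟩)

theorem sum_smul_single_one {m : ℕ} (x : Fin m → ℤ) :
    ∑ i, x i • (Pi.single i 1 : Fin m → ℤ) = x := by
  conv_rhs => rw [← Finset.univ_sum_single x]
  refine Finset.sum_congr rfl fun i _ => ?_
  rw [← Pi.single_smul, smul_eq_mul, mul_one]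

/-! ### Degrees, births and principal submodules in homology. -/

namespace StandardFormChainComplex

variable {m : ℕ} (X : StandardFormChainComplex m)

/-- The degree of a standard unit vector. -/
noncomputable def degree (i : Fin m) : ℤ := (X.homogeneous i).choose

theorem single_mem_degree (i : Fin m) : (Pi.single i 1 : Fin m → ℤ) ∈ X.C (X.degree i) :=
  (X.homogeneous i).choose_spec

/-- The part of `x` outside degree `k` lies both in `C k` and in the sum of the other summands, so
independence makes it zero. -/
theorem mem_C_iff {k : ℤ} {x : Fin m → ℤ} :
    x ∈ X.C k ↔ ∀ i, x i ≠ 0 → X.degree i = k := by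
  constructor
  · intro hx
    set y : Fin m → ℤ := fun i => if X.degree i = k then x i else 0 with hy
    have hyk : y ∈ X.C k := by
      rw [← sum_smul_single_one y]
      refine Submodule.sum_mem _ fun i _ => ?_
      by_cases h : X.degree i = k
      · exact Submodule.smul_mem _ _ (h ▸ X.single_mem_degree i)
      · simp [hy, h]
    have hz : x - y ∈ ⨆ j, ⨆ (_ : j ≠ k), X.C j := by
      rw [← sum_smul_single_one (x - y)]
      refine Submodule.sum_mem _ fun i _ => ?_
      by_cases h : X.degree i = k
      · simp [hy, h]
      · exact Submodule.smul_mem _ _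
          ((le_iSup₂_of_le (f := fun j (_ : j ≠ k) => X.C j) (X.degree i) h le_rfl)
            (X.single_mem_degree i))
    have h0 : x - y = 0 := Submodule.disjoint_def.mp (X.isInternal.submodule_iSupIndep k) _
      (Submodule.sub_mem _ hx hyk) hz
    intro i hi
    by_contra h
    have := congrFun h0 i
    simp [hy, h] at this
    exact hi this
  · intro h
    rw [← sum_smul_single_one x]
    refine Submodule.sum_mem _ fun i _ => ?_
    by_cases hi : x i = 0
    · simp [hi]
    · exact Submodule.smul_mem _ _ (h i hi ▸ X.single_mem_degree i)

theorem single_mem_C_iff {k : ℤ} {i : Fin m} :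
    (Pi.single i 1 : Fin m → ℤ) ∈ X.C k ↔ X.degree i = k := by
  rw [mem_C_iff]
  constructor
  · intro h
    exact h i (by simp)
  · intro h j hj
    by_cases e : j = i
    · rw [e, h]
    · exact absurd (Pi.single_eq_of_ne e _) hj

theorem birth_le_iff {z : Fin m → ℤ} {q : Fin (m + 1)} :
    birth z ≤ q ↔ z ∈ canonicalFiltration m q := by
  classical
  constructor
  · intro h
    exact canonicalFiltration_mono h (mem_canonicalFiltration_birth z)
  · intro h
    unfold birth
    exact Finset.min'_le _ _ (by simpa using h)

theorem principal_carrier_of_le {k : ℤ} (z : X.cycles k (Fin.last m)) {q : Fin (m + 1)}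
    (h : z.1 ∈ X.cycles k q) : (X.principal k z).carrier q =
      Submodule.span ℤ {(Submodule.Quotient.mk ⟨z.1, h⟩ : X.Homology k q)} :=
  PersistenceModule.Sub.generatedBy_carrier_of_le (f := X.persistentHomology k) _
    (birth_le_iff.mpr h.1.2)

theorem principal_carrier_of_not_mem {k : ℤ} (z : X.cycles k (Fin.last m)) {q : Fin (m + 1)}
    (h : z.1 ∉ canonicalFiltration m q) : (X.principal k z).carrier q = ⊥ :=
  PersistenceModule.Sub.generatedBy_carrier_of_not_le (f := X.persistentHomology k) _
    (birth_le_iff.not.mpr h)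

theorem homology_mk_eq_zero_iff {k : ℤ} {q : Fin (m + 1)} (x : X.cycles k q) :
    (Submodule.Quotient.mk x : X.Homology k q) = 0 ↔ x.1 ∈ X.boundaries k q := by
  rw [Submodule.Quotient.mk_eq_zero]
  rfl

/-- A basis of a standard-form chain complex that is compatible with the grading and with the
canonical filtration and in which the differential pairs off basis elements, up to sign. -/
structure BarcodeBasis where
  vec : Fin m → Fin m → ℤ
  coord : (Fin m → ℤ) →ₗ[ℤ] (Fin m → ℤ)
  pair : Fin m → Fin m → Prop
  sign : Fin m → Fin m → ℤˣ
  coord_vec : ∀ j, coord (vec j) = Pi.single j 1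
  sum_coord : ∀ x, ∑ j, coord x j • vec j = x
  coord_eq_zero : ∀ (p : Fin (m + 1)) (x : Fin m → ℤ), x ∈ canonicalFiltration m p →
    ∀ j : Fin m, (p : ℕ) ≤ j → coord x j = 0
  vec_mem_iff : ∀ (p : Fin (m + 1)) (j : Fin m), vec j ∈ canonicalFiltration m p ↔ (j : ℕ) < p
  vec_mem_C : ∀ j, vec j ∈ X.C (X.degree j)
  coord_degree : ∀ (k : ℤ) (x : Fin m → ℤ), x ∈ X.C k → ∀ j, coord x j ≠ 0 → X.degree j = k
  pair_left : ∀ i i' j, pair i j → pair i' j → i = i'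
  pair_right : ∀ i j j', pair i j → pair i j' → j = j'
  pair_disjoint : ∀ i j r, pair i j → ¬ pair r i
  bd_pair : ∀ i j, pair i j → X.bd (vec j) = (sign i j : ℤ) • vec i
  bd_cycle : ∀ j, (∀ i, ¬ pair i j) → X.bd (vec j) = 0

/-! ### Homology computed from a barcode basis. -/

namespace BarcodeBasis

variable {X} (B : X.BarcodeBasis)

/-- The filtration is preserved by `∂` and the sign is invertible, so `i ≤ j`; equality would make
`i` both killer and killed. -/
theorem pair_lt {i j : Fin m} (h : B.pair i j) : i < j := by
  have h1 : X.bd (B.vec j) ∈ canonicalFiltration m j.succ :=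
    X.bd_mem_filtration _ _ ((B.vec_mem_iff _ _).mpr (by simp))
  rw [B.bd_pair i j h] at h1
  have h2 : B.vec i ∈ canonicalFiltration m j.succ := by
    have := Submodule.smul_mem _ ((B.sign i j)⁻¹ : ℤˣ).1 h1
    rwa [smul_smul, Units.inv_mul, one_smul] at this
  rw [B.vec_mem_iff, Fin.val_succ] at h2
  refine lt_of_le_of_ne (Fin.le_def.mpr (by omega)) ?_
  rintro rfl
  exact B.pair_disjoint _ _ _ h h

theorem coord_bd_apply (x : Fin m → ℤ) (i : Fin m) :
    B.coord (X.bd x) i = ∑ j, B.coord x j * B.coord (X.bd (B.vec j)) i := by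
  conv_lhs => rw [← B.sum_coord x]
  simp only [map_sum, map_smul, Finset.sum_apply, Pi.smul_apply, smul_eq_mul]

theorem coord_bd_vec_of_not_pair {i j : Fin m} (h : ¬ B.pair i j) :
    B.coord (X.bd (B.vec j)) i = 0 := by
  by_cases hex : ∃ i', B.pair i' j
  · obtain ⟨i', hi'⟩ := hex
    rw [B.bd_pair i' j hi', map_smul, B.coord_vec, Pi.smul_apply, Pi.single_eq_of_ne, smul_zero]
    rintro rfl
    exact h hi'
  · rw [B.bd_cycle j (not_exists.mp hex), map_zero, Pi.zero_apply]

/-- The pairing is a matching, so only `vec j` has a boundary with a component along `vec i`. -/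
theorem coord_bd_of_pair {i j : Fin m} (h : B.pair i j) (x : Fin m → ℤ) :
    B.coord (X.bd x) i = B.sign i j * B.coord x j := by
  rw [coord_bd_apply, Finset.sum_eq_single j, B.bd_pair i j h, map_smul, B.coord_vec,
    Pi.smul_apply, Pi.single_eq_same, smul_eq_mul, mul_one, mul_comm]
  · intro j' _ hj'
    rw [B.coord_bd_vec_of_not_pair, mul_zero]
    exact fun h' => hj' (B.pair_right _ _ _ h' h)
  · simp

theorem coord_bd_eq_zero {i : Fin m} (h : ∀ j, ¬ B.pair i j) (x : Fin m → ℤ) :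
    B.coord (X.bd x) i = 0 := by
  rw [coord_bd_apply]
  exact Finset.sum_eq_zero fun j _ => by rw [B.coord_bd_vec_of_not_pair (h j), mul_zero]

theorem vec_mem_cycles {j : Fin m} (hj : ∀ i, ¬ B.pair i j) {k : ℤ} (hk : X.degree j = k)
    {q : Fin (m + 1)} (hq : (j : ℕ) < q) : B.vec j ∈ X.cycles k q :=
  ⟨⟨hk ▸ B.vec_mem_C j, (B.vec_mem_iff q j).mpr hq⟩, B.bd_cycle j hj⟩

/-- Since the coefficient is a unit, `vec i` itself, not just a multiple, bounds once `vec j` is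
present. -/
theorem vec_mem_boundaries {i j : Fin m} (h : B.pair i j) {k : ℤ}
    (hk : X.degree i = k) {q : Fin (m + 1)} (hq : (j : ℕ) < q) :
    B.vec i ∈ X.boundaries k q := by
  have hbd := B.bd_pair i j h
  have h1 : X.bd (B.vec j) ∈ X.C (X.degree j - 1) := X.bd_mem _ _ (B.vec_mem_C j)
  have h2 : X.degree i = X.degree j - 1 := by
    refine B.coord_degree _ _ h1 i ?_
    rw [hbd, map_smul, B.coord_vec, Pi.smul_apply, Pi.single_eq_same, smul_eq_mul, mul_one]
    exact (B.sign i j).ne_zero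
  refine ⟨((B.sign i j)⁻¹ : ℤˣ).1 • B.vec j, ⟨?_, ?_⟩, ?_⟩
  · refine Submodule.smul_mem _ _ ?_
    have := B.vec_mem_C j
    rwa [show X.degree j = k + 1 by omega] at this
  · exact Submodule.smul_mem _ _ ((B.vec_mem_iff q j).mpr hq)
  · rw [map_smul, hbd, smul_smul, Units.inv_mul, one_smul]

theorem coord_boundary_eq_zero {k : ℤ} {q : Fin (m + 1)} {x : Fin m → ℤ}
    (hx : x ∈ X.boundaries k q) {i : Fin m} (hi : ∀ j, B.pair i j → (q : ℕ) ≤ j) :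
    B.coord x i = 0 := by
  obtain ⟨y, ⟨-, hy⟩, rfl⟩ := hx
  by_cases h : ∃ j, B.pair i j
  · obtain ⟨j, hj⟩ := h
    rw [B.coord_bd_of_pair hj, B.coord_eq_zero q y hy j (hi j hj), mul_zero]
  · exact B.coord_bd_eq_zero (not_exists.mp h) y

/-- The coordinate of a homology class along a basis element that has not died. -/
noncomputable def homologyCoord (k : ℤ) (q : Fin (m + 1)) (i : Fin m)
    (hi : ∀ j, B.pair i j → (q : ℕ) ≤ j) : X.Homology k q →ₗ[ℤ] ℤ :=
  Submodule.liftQ _ ((LinearMap.proj i : (Fin m → ℤ) →ₗ[ℤ] ℤ) ∘ₗ B.coord ∘ₗ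
    (X.cycles k q).subtype) fun _ hx =>
      LinearMap.mem_ker.mpr (B.coord_boundary_eq_zero (k := k) (q := q) hx hi)

theorem homologyCoord_mk (k : ℤ) (q : Fin (m + 1)) (i : Fin m)
    (hi : ∀ j, B.pair i j → (q : ℕ) ≤ j) (x : X.cycles k q) :
    B.homologyCoord k q i hi (Submodule.Quotient.mk x) = B.coord x.1 i := rfl

/-- The coordinate along `vec i` descends to homology until the partner `j` enters, so the class is
torsion-free up to then. As `vec j` first lies in `K_(j+1)`, death occurs at `j + 1`; without
partner the end is `m + 1`. -/
theorem principal_isInterval {k : ℤ} {i : Fin m} (z : X.cycles k (Fin.last m))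
    (hz : z.1 = B.vec i) : (X.principal k z).toModule.IsInterval := by
  have hk : X.degree i = k := by
    refine B.coord_degree k z.1 z.2.1.1 i ?_
    rw [hz, B.coord_vec, Pi.single_eq_same]
    exact one_ne_zero
  have hle : ∀ q, birth z.1 ≤ q ↔ (i : ℕ) < q := fun q => by
    rw [birth_le_iff, hz, B.vec_mem_iff]
  have hb : (birth z.1 : ℕ) ≤ i + 1 := (hle i.succ).mpr (by simp)
  have halive : ∀ (q : Fin (m + 1)) (h : z.1 ∈ X.cycles k q),
      (∀ j, B.pair i j → (q : ℕ) ≤ j) → ∀ c : ℤ,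
      c • (Submodule.Quotient.mk ⟨z.1, h⟩ : X.Homology k q) = 0 → c = 0 := by
    intro q h hq c hc
    have := congrArg (B.homologyCoord k q i hq) hc
    rwa [map_smul, homologyCoord_mk, map_zero, hz, B.coord_vec, Pi.single_eq_same, smul_eq_mul,
      mul_one] at this
  have hcyc : ∀ q, birth z.1 ≤ q → z.1 ∈ X.cycles k q :=
    fun q h => ⟨⟨z.2.1.1, birth_le_iff.mp h⟩, z.2.2⟩
  by_cases hex : ∃ j, B.pair i j
  · obtain ⟨j, hj⟩ := hex
    refine PersistenceModule.Sub.generatedBy_isInterval (f := X.persistentHomology k) _ (j + 1)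
      ?_ (by omega) ?_ ?_
    · have := Fin.lt_def.mp (B.pair_lt hj)
      omega
    · intro q h hq c hc
      refine halive q (hcyc q h) (fun j' hj' => ?_) c hc
      rw [B.pair_right _ _ _ hj' hj]
      omega
    · intro q h hq
      refine (X.homology_mk_eq_zero_iff ⟨z.1, hcyc q h⟩).mpr ?_
      change z.1 ∈ _
      rw [hz]
      exact B.vec_mem_boundaries hj hk hq
  · refine PersistenceModule.Sub.generatedBy_isInterval (f := X.persistentHomology k) _ (m + 1)
      ?_ le_rfl ?_ ?_
    · omega
    · intro q h hq c hc
      exact halive q (hcyc q h) (fun j' hj' => absurd ⟨j', hj'⟩ hex) c hc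
    · intro q h hq
      omega

theorem isInternalDirectSum {k : ℤ} {ι : Type} [DecidableEq ι] (e : ι → Fin m)
    (he : Function.Injective e)
    (hrange : ∀ j, (∃ a, e a = j) ↔ X.degree j = k ∧ ∀ i, ¬ B.pair i j)
    (z : ι → X.cycles k (Fin.last m)) (hz : ∀ a, (z a).1 = B.vec (e a)) :
    PersistenceModule.IsInternalDirectSum fun a => X.principal k (z a) := by
  classical
  intro q
  have hunp : ∀ a i, ¬ B.pair i (e a) := fun a => ((hrange _).mp ⟨a, rfl⟩).2
  have hdeg : ∀ a, X.degree (e a) = k := fun a => ((hrange _).mp ⟨a, rfl⟩).1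
  have hcyc : ∀ a, (e a : ℕ) < q → (z a).1 ∈ X.cycles k q := fun a h => by
    rw [hz]
    exact B.vec_mem_cycles (hunp a) (hdeg a) h
  let p : ι → Submodule ℤ (X.Homology k q) := fun a => (X.principal k (z a)).carrier q
  have hp : ∀ a (h : (e a : ℕ) < q),
      p a = Submodule.span ℤ {Submodule.Quotient.mk ⟨(z a).1, hcyc a h⟩} :=
    fun a h => X.principal_carrier_of_le (z a) (hcyc a h)
  have hp' : ∀ a, ¬ (e a : ℕ) < q → p a = ⊥ := fun a h =>
    X.principal_carrier_of_not_mem (z a) (by rwa [hz, B.vec_mem_iff])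
  refine (DirectSum.isInternal_submodule_iff_iSupIndep_and_iSup_eq_top p).mpr ⟨?_, ?_⟩
  -- The default `0` is used only when the class of `z a` is dead at `q` or not yet born; its
  -- summand is then zero.
  · let φ : ι → X.Homology k q →ₗ[ℤ] ℤ := fun a =>
      if h : ∀ j, B.pair (e a) j → (q : ℕ) ≤ j then B.homologyCoord k q (e a) h else 0
    refine iSupIndep_of_separating p φ ?_ ?_
    · intro a b hab x hx
      by_cases hb : (e b : ℕ) < q
      · rw [hp b hb, Submodule.mem_span_singleton] at hx
        obtain ⟨c, rfl⟩ := hx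
        rw [map_smul]
        by_cases h : ∀ j, B.pair (e a) j → (q : ℕ) ≤ j
        · simp only [φ, dif_pos h]
          rw [homologyCoord_mk, hz, B.coord_vec, Pi.single_eq_of_ne, smul_zero]
          exact fun h' => hab (he h').symm
        · simp only [φ, dif_neg h, LinearMap.zero_apply, smul_zero]
      · rw [hp' b hb, Submodule.mem_bot] at hx
        rw [hx, map_zero]
    · intro a x hx hx0
      by_cases ha : (e a : ℕ) < q
      · rw [hp a ha, Submodule.mem_span_singleton] at hx
        obtain ⟨c, rfl⟩ := hx
        by_cases h : ∀ j, B.pair (e a) j → (q : ℕ) ≤ j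
        · simp only [φ, dif_pos h] at hx0
          rw [map_smul, homologyCoord_mk, hz, B.coord_vec, Pi.single_eq_same, smul_eq_mul,
            mul_one] at hx0
          rw [hx0, zero_smul]
        · push Not at h
          obtain ⟨j, hj, hjq⟩ := h
          have : (Submodule.Quotient.mk ⟨(z a).1, hcyc a ha⟩ : X.Homology k q) = 0 := by
            rw [homology_mk_eq_zero_iff]
            change (z a).1 ∈ _
            rw [hz]
            exact B.vec_mem_boundaries hj (hdeg a) hjq
          rw [this, smul_zero]
      · rw [hp' a ha, Submodule.mem_bot] at hx
        exact hx
  · rw [eq_top_iff]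
    rintro x -
    obtain ⟨x, rfl⟩ := Submodule.Quotient.mk_surjective _ x
    -- Cycles whose class lies in the sum, seen in `ℤ^m`, so that membership can be tested on each
    -- term of the expansion of `x`.
    let T : Submodule ℤ (Fin m → ℤ) :=
      ((⨆ a, p a).comap (Submodule.mkQ _)).map (X.cycles k q).subtype
    have hT : x.1 ∈ T := by
      rw [← B.sum_coord x.1]
      refine Submodule.sum_mem _ fun j _ => ?_
      by_cases h0 : B.coord x.1 j = 0
      · rw [h0, zero_smul]
        exact Submodule.zero_mem _
      · refine Submodule.smul_mem _ _ ?_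
        have hjq : (j : ℕ) < q := by
          by_contra hjq
          exact h0 (B.coord_eq_zero q x.1 x.2.1.2 j (not_lt.mp hjq))
        -- A cycle has no component along a `vec j` with nonzero boundary.
        have hj : X.degree j = k ∧ ∀ i, ¬ B.pair i j := by
          refine ⟨B.coord_degree k x.1 x.2.1.1 j h0, fun i hi => h0 ?_⟩
          have := B.coord_bd_of_pair hi x.1
          rw [show X.bd x.1 = 0 from x.2.2, map_zero, Pi.zero_apply] at this
          exact (mul_eq_zero.mp this.symm).resolve_left (B.sign i j).ne_zero
        obtain ⟨a, rfl⟩ := (hrange j).mpr hj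
        refine ⟨⟨(z a).1, hcyc a hjq⟩, ?_, hz a⟩
        refine (le_iSup p a) ?_
        rw [hp a hjq]
        exact Submodule.mem_span_singleton_self _
    obtain ⟨y, hy, hyx⟩ := hT
    obtain rfl : y = x := Subtype.ext hyx
    exact hy

end BarcodeBasis

end StandardFormChainComplex

/-! ### Unit pivots give a barcode basis, and splitting forces unit pivots. -/

namespace StandardFormChainComplex

variable {m : ℕ} (X : StandardFormChainComplex m)

theorem boundaryMatrix_degree {i j : Fin m} (h : X.boundaryMatrix i j ≠ 0) :
    X.degree j = X.degree i + 1 := by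
  rw [boundaryMatrix_apply, Int.cast_ne_zero] at h
  have := X.mem_C_iff.mp (X.bd_mem _ _ (X.single_mem_degree j)) i h
  omega

theorem antiTranspose_Vhat_degree {i j : Fin m} (h : antiTranspose X.Vhat i j ≠ 0) :
    X.degree i = X.degree j := by
  have := X.isPartialReduction_hat.graded (fun i => X.degree i.rev)
    (fun a b hab => X.boundaryMatrix_degree hab) j.rev i.rev h
  simpa using this.symm

theorem matK_inv_degree {i j : Fin m} (h : X.matK⁻¹ i j ≠ 0) : X.degree i = X.degree j :=
  graded_inv (X.isRowReduction_hat.completion_mul_inv_self X.isCompletion_matK)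
    (X.isRowReduction_hat.completion_inv_mul_self X.isCompletion_matK)
    (X.isRowReduction_hat.completion_graded X.isCompletion_matK
      (fun _ _ => X.boundaryMatrix_degree) fun _ _ => X.antiTranspose_Vhat_degree) i j h

theorem matK_inv_diag (j : Fin m) : X.matK⁻¹ j j = 1 :=
  (upper_unitriangular_inv (X.isRowReduction_hat.completion_diag X.isCompletion_matK)
    (X.isRowReduction_hat.completion_upper X.isCompletion_matK)).1 j

theorem matK_inv_upper {i j : Fin m} (h : j < i) : X.matK⁻¹ i j = 0 :=
  (upper_unitriangular_inv (X.isRowReduction_hat.completion_diag X.isCompletion_matK)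
    (X.isRowReduction_hat.completion_upper X.isCompletion_matK)).2 i j h

theorem boundaryMatrix_mul_matK_inv :
    X.boundaryMatrix * X.matK⁻¹ = X.matK⁻¹ * leadMatrix (antiTranspose X.Rhat) :=
  X.isRowReduction_hat.mul_completion_inv X.boundaryMatrix_mul_self X.isCompletion_matK

theorem boundaryMatrix_mul_matK_inv_of_lead {i j : Fin m}
    (h : lead (antiTranspose X.Rhat) i = j) (a : Fin m) :
    (X.boundaryMatrix * X.matK⁻¹) a j = antiTranspose X.Rhat i j * X.matK⁻¹ a i := by
  rw [boundaryMatrix_mul_matK_inv, Matrix.mul_apply, Finset.sum_eq_single i, leadMatrix_apply,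
    if_pos h, mul_comm]
  · intro b _ hb
    rw [leadMatrix_apply, if_neg, mul_zero]
    exact fun h' => hb (X.isRowReduction_hat.lead_inj _ _ _ h' h)
  · simp

theorem boundaryMatrix_mul_matK_inv_of_forall_ne {j : Fin m}
    (h : ∀ i, lead (antiTranspose X.Rhat) i ≠ j) (a : Fin m) :
    (X.boundaryMatrix * X.matK⁻¹) a j = 0 := by
  rw [boundaryMatrix_mul_matK_inv, Matrix.mul_apply]
  exact Finset.sum_eq_zero fun b _ => by rw [leadMatrix_col_eq_zero_iff.mpr h, mul_zero]

theorem boundaryMatrix_mem_range (i j : Fin m) :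
    X.boundaryMatrix i j ∈ (Int.castRingHom ℚ).range := by
  rw [boundaryMatrix_apply]
  exact ⟨_, rfl⟩

theorem hasUnitTrailingCoefficients_iff : HasUnitTrailingCoefficients X.Rhat ↔
    ∀ r i : Fin m, lead (antiTranspose X.Rhat) r = i →
      ∃ u : ℤˣ, antiTranspose X.Rhat r i = ((u : ℤ) : ℚ) := by
  constructor
  · intro h r i hri
    exact h _ _ (lead_antiTranspose.mp hri)
  · intro h i j hij
    have := h j.rev i.rev (lead_antiTranspose.mpr (by simpa using hij))
    simpa [antiTranspose] using this

theorem inv_cast_unit_mem_range (u : ℤˣ) : (((u : ℤ) : ℚ))⁻¹ ∈ (Int.castRingHom ℚ).range := by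
  refine ⟨((u⁻¹ : ℤˣ) : ℤ), ?_⟩
  rcases Int.units_eq_one_or u with rfl | rfl <;> norm_num

/-- A row of the anti-transpose of `Vhat` is integral if the rows of the anti-transpose of `Rhat`
below it have unit leading coefficients. -/
theorem antiTranspose_Vhat_mem_range {r : Fin m}
    (h : ∀ r' i : Fin m, r < r' → lead (antiTranspose X.Rhat) r' = i →
      ∃ u : ℤˣ, antiTranspose X.Rhat r' i = ((u : ℤ) : ℚ)) (i : Fin m) :
    antiTranspose X.Vhat r i ∈ (Int.castRingHom ℚ).range := by
  refine X.isPartialReduction_hat.integral _ (fun a b => X.boundaryMatrix_mem_range _ _) r.rev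
    (Fin.is_lt _) (fun j hj a ha => ?_) i.rev
  obtain ⟨u, hu⟩ := h j.rev a.rev (Fin.lt_rev_iff.mpr hj)
    (lead_antiTranspose.mpr (by simpa using ha))
  have hu' : X.Rhat a j = ((u : ℤ) : ℚ) := by simpa [antiTranspose] using hu
  rw [hu']
  exact inv_cast_unit_mem_range u

theorem bd_apply_eq_mulVec (x : Fin m → ℤ) :
    X.bd x = (LinearMap.toMatrix' X.bd).mulVec x := by
  rw [LinearMap.toMatrix'_mulVec]

theorem cast_bd_apply (x : Fin m → ℤ) (a : Fin m) :
    ((X.bd x a : ℤ) : ℚ) = ∑ i, X.boundaryMatrix a i * x i := by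
  rw [bd_apply_eq_mulVec, Matrix.mulVec, dotProduct, Int.cast_sum]
  exact Finset.sum_congr rfl fun i _ => by rw [Int.cast_mul]; rfl

/-- If the trailing coefficients are units, the columns of the inverse of `K` form a basis in which
the differential pairs off basis elements. -/
theorem exists_barcodeBasis (h : HasUnitTrailingCoefficients X.Rhat) :
    ∃ B : X.BarcodeBasis, (∀ i j, B.pair i j ↔ lead (antiTranspose X.Rhat) i = j) ∧
      ∀ j a, ((B.vec j a : ℤ) : ℚ) = X.matK⁻¹ a j := by
  classical
  rw [hasUnitTrailingCoefficients_iff] at h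
  have hK : ∀ i j, X.matK i j ∈ (Int.castRingHom ℚ).range :=
    X.isRowReduction_hat.completion_mem_subring X.isCompletion_matK X.boundaryMatrix_mem_range
      (fun r => X.antiTranspose_Vhat_mem_range fun r' i _ => h r' i) fun r i hri => by
        obtain ⟨u, hu⟩ := h r i hri
        rw [hu]
        exact inv_cast_unit_mem_range u
  choose P hP using hK
  have hP' : ∀ i j, ((P i j : ℤ) : ℚ) = X.matK i j := hP
  have hPd : ∀ j, P j j = 1 := fun j => by
    have := X.isRowReduction_hat.completion_diag X.isCompletion_matK j
    rw [← hP'] at this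
    exact_mod_cast this
  have hPu : ∀ i j, j < i → P i j = 0 := fun i j hij => by
    have := X.isRowReduction_hat.completion_upper X.isCompletion_matK i j hij
    rw [← hP'] at this
    exact_mod_cast this
  let PM : Matrix (Fin m) (Fin m) ℤ := Matrix.of P
  have hdet : IsUnit PM.det := by
    rw [upper_unitriangular_det (K := PM) hPd hPu]
    exact isUnit_one
  have hPL : PM * PM⁻¹ = 1 := Matrix.mul_nonsing_inv _ hdet
  have hLP : PM⁻¹ * PM = 1 := Matrix.nonsing_inv_mul _ hdet
  -- The inverse taken over `ℤ` is also an inverse over `ℚ`, hence equals `K⁻¹`.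
  have hL : ∀ i j, ((PM⁻¹ i j : ℤ) : ℚ) = X.matK⁻¹ i j := by
    have h1 : PM.map (Int.castRingHom ℚ) = X.matK := by
      ext i j
      exact hP' i j
    have h2 : X.matK * (PM⁻¹).map (Int.castRingHom ℚ) = 1 := by
      rw [← h1, ← Matrix.map_mul, hPL, Matrix.map_one _ (map_zero _) (map_one _)]
    intro i j
    rw [Matrix.inv_eq_right_inv h2]
    rfl
  have hLd : ∀ j, PM⁻¹ j j = 1 := (upper_unitriangular_inv (K := PM) hPd hPu).1
  have hLu : ∀ i j, j < i → PM⁻¹ i j = 0 := (upper_unitriangular_inv (K := PM) hPd hPu).2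
  have hPdeg : ∀ i j, P i j ≠ 0 → X.degree i = X.degree j := fun i j hij => by
    refine X.isRowReduction_hat.completion_graded X.isCompletion_matK
      (fun _ _ => X.boundaryMatrix_degree) (fun _ _ => X.antiTranspose_Vhat_degree) i j ?_
    rw [← hP']
    exact_mod_cast hij
  have hbd : ∀ j a, ((X.bd (fun b => PM⁻¹ b j) a : ℤ) : ℚ) =
      (X.boundaryMatrix * X.matK⁻¹) a j := by
    intro j a
    rw [cast_bd_apply, Matrix.mul_apply]
    exact Finset.sum_congr rfl fun b _ => by rw [hL]
  let sign : Fin m → Fin m → ℤˣ := fun i j =>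
    if hij : lead (antiTranspose X.Rhat) i = j then (h i j hij).choose else 1
  have hsign : ∀ i j : Fin m, lead (antiTranspose X.Rhat) i = j →
      antiTranspose X.Rhat i j = ((sign i j : ℤ) : ℚ) := by
    intro i j hij
    simp only [sign, dif_pos hij]
    exact (h i j hij).choose_spec
  refine ⟨{
    vec := fun j a => PM⁻¹ a j
    coord := PM.mulVecLin
    pair := fun i j => lead (antiTranspose X.Rhat) i = j
    sign := sign
    coord_vec := fun j => ?_
    sum_coord := fun x => ?_
    coord_eq_zero := fun p x hx j hj => ?_
    vec_mem_iff := fun p j => ?_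
    vec_mem_C := fun j => ?_
    coord_degree := fun k x hx j hj => ?_
    pair_left := fun i i' j => X.isRowReduction_hat.lead_inj i i' j
    pair_right := fun i j j' hj hj' => WithTop.coe_injective (hj.symm.trans hj')
    -- If row `r` leads in column `i`, row `i` of `S` is zero and has no lead.
    pair_disjoint := fun i j r hj hr => (lead_eq_coe_iff.mp hj).1
      (X.isRowReduction_hat.row_eq_zero_of_lead X.boundaryMatrix_mul_self hr j)
    bd_pair := fun i j hij => ?_
    bd_cycle := fun j hj => ?_ }, fun _ _ => Iff.rfl, fun j a => hL a j⟩
  · ext a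
    have := congrFun (congrFun hPL a) j
    rw [Matrix.mul_apply, Matrix.one_apply] at this
    rw [Pi.single_apply]
    exact this
  · have : PM⁻¹.mulVec (PM.mulVec x) = x := by
      rw [Matrix.mulVec_mulVec, hLP, Matrix.one_mulVec]
    conv_rhs => rw [← this]
    ext a
    rw [Finset.sum_apply, Matrix.mulVec, dotProduct]
    exact Finset.sum_congr rfl fun i _ => mul_comm _ _
  · rw [mem_canonicalFiltration_iff] at hx
    change ∑ i, P j i * x i = 0
    refine Finset.sum_eq_zero fun i _ => ?_
    rcases lt_or_ge i j with hij | hij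
    · rw [hPu _ _ hij, zero_mul]
    · rw [hx i (hj.trans hij), mul_zero]
  · rw [mem_canonicalFiltration_iff]
    constructor
    · intro h0
      by_contra hlt
      have := h0 j (not_lt.mp hlt)
      rw [hLd] at this
      exact one_ne_zero this
    · intro hjp i hi
      exact hLu i j (Fin.lt_def.mpr (hjp.trans_le hi))
  · rw [mem_C_iff]
    intro i hi
    refine X.matK_inv_degree ?_
    rw [← hL]
    exact_mod_cast hi
  · rw [mem_C_iff] at hx
    obtain ⟨i, -, hi⟩ := Finset.exists_ne_zero_of_sum_ne_zero (show ∑ i, P j i * x i ≠ 0 from hj)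
    rw [hPdeg j i (left_ne_zero_of_mul hi), hx i (right_ne_zero_of_mul hi)]
  · ext a
    have := hbd j a
    rw [X.boundaryMatrix_mul_matK_inv_of_lead hij, hsign i j hij, ← hL] at this
    exact_mod_cast this
  · ext a
    have := hbd j a
    rw [X.boundaryMatrix_mul_matK_inv_of_forall_ne hj] at this
    exact_mod_cast this

/-- If the persistent homology splits into intervals, then the relative homology groups of the
filtration are torsion-free. -/
theorem exists_eq_bd_add_of_smul_eq
    (h : ∀ k : ℤ, (X.persistentHomology k).SplitsIntoIntervals) {p q : Fin (m + 1)} (hpq : p ≤ q)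
    {k n : ℤ} (hn : n ≠ 0) {x y u : Fin m → ℤ} (hx : x ∈ X.C k)
    (hxq : x ∈ canonicalFiltration m q) (hy : y ∈ X.C (k + 1))
    (hyq : y ∈ canonicalFiltration m q) (hu : u ∈ X.C k) (hup : u ∈ canonicalFiltration m p)
    (e : n • x = X.bd y + u) :
    ∃ y' ∈ canonicalFiltration m q, ∃ u' ∈ canonicalFiltration m p, x = X.bd y' + u' := by
  have hbb : ∀ v, X.bd (X.bd v) = 0 := LinearMap.congr_fun X.bd_bd
  have hk : k - 1 + 1 = k := sub_add_cancel k 1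
  have e1 : n • X.bd x = X.bd u := by rw [← map_smul, e, map_add, hbb, zero_add]
  have h1 : X.bd x ∈ X.cycles (k - 1) p := by
    refine ⟨⟨X.bd_mem _ _ hx, mem_canonicalFiltration_iff.mpr fun i hi => ?_⟩, hbb x⟩
    have := mem_canonicalFiltration_iff.mp (X.bd_mem_filtration _ _ hup) i hi
    rw [← e1, Pi.smul_apply, smul_eq_mul] at this
    exact (mul_eq_zero.mp this).resolve_left hn
  -- `n • ∂x = ∂u` bounds in `K_p`, so torsion-freeness of homology makes `∂x = ∂v` with `v` in
  -- `K_p`; then `x - v` is an absolute cycle.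
  have h2 : (Submodule.Quotient.mk ⟨X.bd x, h1⟩ : X.Homology (k - 1) p) = 0 := by
    refine (h (k - 1)).eq_zero_of_smul_eq_zero (p := p) hn _ ?_
    refine (X.homology_mk_eq_zero_iff (n • ⟨X.bd x, h1⟩)).mpr ?_
    change n • X.bd x ∈ _
    rw [e1]
    exact ⟨u, ⟨hk.symm ▸ hu, hup⟩, rfl⟩
  obtain ⟨v, ⟨hv, hvp⟩, hvx⟩ := (X.homology_mk_eq_zero_iff _).mp h2
  replace hv : v ∈ X.C k := hk ▸ hv
  replace hvx : X.bd v = X.bd x := hvx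
  have h3 : x - v ∈ X.cycles k q := by
    refine ⟨⟨Submodule.sub_mem _ hx hv,
      Submodule.sub_mem _ hxq (canonicalFiltration_mono hpq hvp)⟩, ?_⟩
    change X.bd (x - v) = 0
    rw [map_sub, hvx, sub_self]
  have h4 : u - n • v ∈ X.cycles k p := by
    refine ⟨⟨Submodule.sub_mem _ hu (Submodule.smul_mem _ _ hv),
      Submodule.sub_mem _ hup (Submodule.smul_mem _ _ hvp)⟩, ?_⟩
    change X.bd (u - n • v) = 0
    rw [map_sub, map_smul, hvx, e1, sub_self]
  -- A multiple of the class of `x - v` comes from `K_p`; the torsion-free cokernel lets the class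
  -- itself come from `K_p`.
  have h5 : n • (Submodule.Quotient.mk ⟨x - v, h3⟩ : X.Homology k q) =
      X.homologyMap k hpq (Submodule.Quotient.mk ⟨u - n • v, h4⟩) := by
    refine (Submodule.Quotient.eq _).mpr ?_
    refine ⟨y, ⟨hy, hyq⟩, ?_⟩
    change X.bd y = n • (x - v) - (u - n • v)
    rw [smul_sub, e]
    abel
  obtain ⟨w, hw⟩ := (h k).exists_map_eq_of_smul_eq_map (homOfLE hpq) hn _ _ h5
  obtain ⟨w, rfl⟩ := Submodule.Quotient.mk_surjective _ w
  obtain ⟨y', ⟨-, hy'⟩, e'⟩ := (Submodule.Quotient.eq _).mp hw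
  replace e' : X.bd y' = (x - v) - w.1 := e'
  refine ⟨y', hy', v + w.1, Submodule.add_mem _ hvp w.2.1.2, ?_⟩
  rw [e']
  abel

theorem exists_integral_multiple (v : Fin m → ℚ) :
    ∃ n : ℤ, n ≠ 0 ∧ ∃ y : Fin m → ℤ, ∀ a, ((y a : ℤ) : ℚ) = n * v a := by
  obtain ⟨⟨n, hn⟩, hy⟩ := IsLocalization.exist_integer_multiples_of_finite (nonZeroDivisors ℤ) v
  choose y hy using hy
  refine ⟨n, nonZeroDivisors.ne_zero hn, y, fun a => ?_⟩
  exact (hy a).trans (zsmul_eq_mul _ _)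

/-- If the persistent homology splits into intervals, then the trailing coefficients are units. -/
theorem hasUnitTrailingCoefficients_of_splitsIntoIntervals
    (h : ∀ k : ℤ, (X.persistentHomology k).SplitsIntoIntervals) :
    HasUnitTrailingCoefficients X.Rhat := by
  rw [hasUnitTrailingCoefficients_iff]
  intro r
  -- Rows are treated from the bottom up, the order in which the algorithm meets them as columns.
  induction r using (wellFounded_gt (α := Fin m)).induction with
  | _ r ih =>
  intro l hl
  choose w hw using X.antiTranspose_Vhat_mem_range fun r' i hr' => ih r' hr' i
  replace hw : ∀ i, ((w i : ℤ) : ℚ) = antiTranspose X.Vhat r i := hw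
  -- The functional `x ↦ w · ∂x` is row `r` of `S`; this also shows that the leading entry is an
  -- integer.
  have hS : ∀ x : Fin m → ℤ, ((∑ a, w a * X.bd x a : ℤ) : ℚ) =
      ∑ i, antiTranspose X.Rhat r i * x i := by
    intro x
    simp only [Int.cast_sum, Int.cast_mul, hw, cast_bd_apply, X.isRowReduction_hat.eq_mul,
      Matrix.mul_apply, Finset.mul_sum, Finset.sum_mul]
    rw [Finset.sum_comm]
    exact Finset.sum_congr rfl fun i _ => Finset.sum_congr rfl fun a _ => by ring
  obtain ⟨hne, hlt⟩ := lead_eq_coe_iff.mp hl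
  obtain ⟨c, hc⟩ : ∃ c : ℤ, (c : ℚ) = antiTranspose X.Rhat r l := by
    refine ⟨_, (hS (Pi.single l 1)).trans ?_⟩
    rw [Finset.sum_eq_single l]
    · simp
    · intro b _ hb
      simp [hb]
    · simp
  have hc0 : c ≠ 0 := by
    rintro rfl
    exact hne (by rw [← hc, Int.cast_zero])
  obtain ⟨n, hn, y, hy⟩ := exists_integral_multiple fun a => X.matK⁻¹ a l
  have hbdy : ∀ a, ((X.bd y a : ℤ) : ℚ) = (c * n : ℤ) * X.matK⁻¹ a r := by
    intro a
    have h1 : ((X.bd y a : ℤ) : ℚ) = n * (X.boundaryMatrix * X.matK⁻¹) a l := by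
      rw [cast_bd_apply, Matrix.mul_apply, Finset.mul_sum]
      exact Finset.sum_congr rfl fun i _ => by rw [hy]; ring
    rw [h1, X.boundaryMatrix_mul_matK_inv_of_lead hl, ← hc]
    push_cast
    ring
  have hyq : y ∈ canonicalFiltration m l.succ := by
    rw [mem_canonicalFiltration_iff]
    intro i hi
    have := hy i
    rw [X.matK_inv_upper (Fin.lt_def.mpr (by simpa using hi)), mul_zero] at this
    exact_mod_cast this
  have hbdr : X.bd y r = c * n := by
    have := hbdy r
    rw [matK_inv_diag, mul_one] at this
    exact_mod_cast this
  have hrl : r ≤ l := by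
    by_contra hlt'
    have := mem_canonicalFiltration_iff.mp (X.bd_mem_filtration _ _ hyq) r
      (by simpa using not_le.mp hlt')
    rw [hbdr] at this
    exact mul_ne_zero hc0 hn this
  have hdeg : X.degree l = X.degree r + 1 := by
    have hSrl := hne
    rw [X.isRowReduction_hat.eq_mul] at hSrl
    obtain ⟨a, ha, ha'⟩ := exists_ne_zero_of_mul_apply_ne_zero hSrl
    rw [X.boundaryMatrix_degree ha', X.antiTranspose_Vhat_degree ha]
  have hyC : y ∈ X.C (X.degree r + 1) := by
    rw [mem_C_iff]
    intro i hi
    rw [← hdeg]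
    refine X.matK_inv_degree fun h0 => hi ?_
    have := hy i
    rw [h0, mul_zero] at this
    exact_mod_cast this
  have hbdyC : X.bd y ∈ X.C (X.degree r) := by simpa using X.bd_mem _ _ hyC
  -- `r.castSucc` stops just before `σ_r` and `l.succ` just after `σ_l`. The remainder lies in the
  -- smaller term because column `r` of `K⁻¹` ends with `1` in row `r`.
  obtain ⟨y', hy', u', hu', e⟩ := X.exists_eq_bd_add_of_smul_eq h (p := r.castSucc) (q := l.succ)
    (Fin.le_def.mpr (by simpa using Nat.le_succ_of_le hrl)) (mul_ne_zero hc0 hn)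
    (X.single_mem_degree r)
    (mem_canonicalFiltration_iff.mpr fun i hi => Pi.single_eq_of_ne (by
      rintro rfl
      have := Fin.le_def.mp hrl
      rw [Fin.val_succ] at hi
      omega) _)
    hyC hyq (u := (c * n) • Pi.single r 1 - X.bd y)
    (Submodule.sub_mem _ (Submodule.smul_mem _ _ (X.single_mem_degree r)) hbdyC)
    (mem_canonicalFiltration_iff.mpr fun i hi => by
      rcases (Fin.le_def.mpr hi : r ≤ i).eq_or_lt with rfl | hri
      · simp [hbdr]
      · have := hbdy i
        rw [X.matK_inv_upper hri, mul_zero] at this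
        have : X.bd y i = 0 := by exact_mod_cast this
        simp [this, hri.ne'])
    (by abel)
  have e1 : ∑ a, w a * (Pi.single r 1 : Fin m → ℤ) a = 1 := by
    rw [Finset.sum_eq_single r]
    · have := hw r
      rw [X.isRowReduction_hat.diag] at this
      simpa using this
    · intro b _ hb
      simp [hb]
    · simp
  have e2 : ∑ a, w a * u' a = 0 := by
    refine Finset.sum_eq_zero fun a _ => ?_
    rcases lt_or_ge a r with har | har
    · have := hw a
      rw [X.isRowReduction_hat.upper _ _ har] at this
      rw [Int.cast_eq_zero.mp this, zero_mul]
    · rw [mem_canonicalFiltration_iff.mp hu' a har, mul_zero]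
  -- Row `r` of `S` starts at `l` and `y'` ends at `l` or earlier, so only one term survives.
  have e3 : ((∑ a, w a * X.bd y' a : ℤ) : ℚ) = (c * y' l : ℤ) := by
    rw [hS, Finset.sum_eq_single l, ← hc, Int.cast_mul]
    · intro b _ hb
      rcases lt_or_gt_of_ne hb with hbl | hbl
      · rw [hlt b hbl, zero_mul]
      · rw [mem_canonicalFiltration_iff.mp hy' b (by simpa using hbl), Int.cast_zero, mul_zero]
    · simp
  have e4 : c * y' l = 1 := by
    rw [← Int.cast_inj.mp e3, ← e1, e]
    simp only [Pi.add_apply, mul_add, Finset.sum_add_distrib, e2, add_zero]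
  exact ⟨Units.mkOfMulEqOne _ _ e4, hc.symm⟩

end StandardFormChainComplex

theorem mainTheorem6 {m : ℕ} (X : StandardFormChainComplex m) :
    List.TFAE [
      HasUnitTrailingCoefficients X.Rhat,
      ∀ k : ℤ, (X.persistentHomology k).SplitsIntoIntervals,
      ∀ k : ℤ, ∃ z : X.EIndex k → X.cycles k (Fin.last m),
        (∀ (j : X.EIndex k) (a : Fin m), (((z j).1 a : ℤ) : ℚ) = X.matK⁻¹ a j.1) ∧
        (∀ j : X.EIndex k, (X.principal k (z j)).toModule.IsInterval) ∧
        PersistenceModule.IsInternalDirectSum fun j : X.EIndex k => X.principal k (z j)] := by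
  tfae_have 1 → 3 := by
    intro h k
    obtain ⟨B, hpair, hvec⟩ := X.exists_barcodeBasis h
    -- As `M` consists of the leading entries, its zero columns index the basis vectors that are
    -- cycles.
    have hE : ∀ j : Fin m, ((Pi.single j 1 : Fin m → ℤ) ∈ X.C k ∧ ∀ i, X.matM i j = 0) ↔
        X.degree j = k ∧ ∀ i, ¬ B.pair i j := fun j => by
      simp only [X.single_mem_C_iff, X.matM_eq, leadMatrix_col_eq_zero_iff, hpair, ne_eq]
    let z : X.EIndex k → X.cycles k (Fin.last m) := fun j =>
      ⟨B.vec j.1, B.vec_mem_cycles ((hE j.1).mp j.2).2 ((hE j.1).mp j.2).1 (Fin.is_lt _)⟩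
    refine ⟨z, fun j a => hvec j.1 a, fun j => B.principal_isInterval (z j) rfl, ?_⟩
    refine B.isInternalDirectSum (fun j : X.EIndex k => j.1) Subtype.val_injective
      (fun j => ?_) z fun _ => rfl
    rw [← hE]
    exact ⟨fun ⟨a, ha⟩ => ha ▸ a.2, fun hj => ⟨⟨j, hj⟩, rfl⟩⟩
  tfae_have 3 → 2 := by
    intro h k
    obtain ⟨z, -, hI, hz⟩ := h k
    have : Finite (X.EIndex k) := Subtype.finite
    exact .of_isInternalDirectSum _ hz hI
  tfae_have 2 → 1 := X.hasUnitTrailingCoefficients_of_splitsIntoIntervals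
  tfae_finish
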